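/- Let $K$ be a complex Krein space with indefinite Hermitian inner product $(\cdot,\cdot)$ and fundamental decomposition $K=K^+\dotplus K^-$ (orthogonal subspaces, $K^+$ complete and positive definite, $K^-$ complete and negative definite in the norm $|(x,x)|^{1/2}$). Let $J(x_++x_-)=x_+-x_-$ be its fundamental symmetry, and let $(x,y)_J=(x,Jy)$, so that $(K,(\cdot,\cdot)_J)$ is a Hilbert space. For a densely defined operator $A$ on $K$ let $A^+$ and $A^*$ be its adjoints with respect to $(\cdot,\cdot)$ and $(\cdot,\cdot)_J$. Let $(a,a^+)$ be an anti-Fock representation of the CCR on $K$: $a$ is an operator and $D$ a dense linear manifold contained in the domains of $a$ and $a^+$ and stable under both, with $[a,a^+]=I$ on $D$, and there are vectors $\psi_{-n}\in D$ ($n=1,2,\dots$) with $\psi_{-1}\neq0$, $a^+\psi_{-1}=0$ and $\psi_{-n}=\frac{a^{n-1}}{\sqrt{(n-1)!}}\psi_{-1}$, whose linear span is dense in $K$. Assume that the fundamental decomposition is adapted to the representation: each $\psi_{-n}$ lies in $K^+$ or in $K^-$. Set $b=a^+$. Then $b^*$ is an extension of $-a$ and equals $-\overline a$, where $\overline a$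 is the closure of $a$ (so $b^*=-a$ if $a$ is closed), and $[b,b^*]=I$ on $D$. The operators $$\tilde P=\frac1{\sqrt2\,i}(a^++a),\qquad \tilde Q=\frac1{\sqrt2}(a^+-a),$$ defined on the intersection of the domains of $a$ and $a^+$, are essentially self-adjoint on the Hilbert space $(K,(\cdot,\cdot)_J)$, that is, densely defined with self-adjoint closures, again denoted $\tilde P$ and $\tilde Q$; and $[\tilde P,\tilde Q]=-iI$ on $D$. The Hilbert space $(K,(\cdot,\cdot)_J)$ is separable, and the strongly continuous one-parameter unitary groups $U(t)=e^{it\tilde P}$ and $V(s)=e^{is\tilde Q}$ (with infinitesimal generators $i\tilde P$ and $i\tilde Q$) satisfy the Weyl relations $$U(t)V(s)=e^{ist}V(s)U(t)\qquad(s,t\in\mathbb R).$$ The pair $(U,V)$ is unitarily equivalent to a direct sum of Schrödinger representations: there are an index set $I$ and a unitary operator from $(K,(\cdot,\cdot)_J)$ onto the Hilbert direct sum $\bigoplus_{i\in I}L^2(\mathbb R)$ that carries $U(t)$ and $V(s)$, in each summand, to $e^{itp}\colon f\mapsto f(\cdot+t)$ and $e^{isq}\colon f\mapsto e^{is\,\cdot\,}f$,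 where $pf=-if'$ and $(qf)(x)=xf(x)$. -/

import Mathlib

open Filter Topology MeasureTheory

universe u

/-- A (complex) Krein space with a chosen fundamental decomposition: a Hermitian form `(·,·)` on a
complex vector space `K` (conjugate linear in the first variable) and a decomposition
`K = K⁺ ∔ K⁻` into orthogonal subspaces, the form being positive definite on `K⁺`, negative
definite on `K⁻`, and both being complete in the norm `|(x, x)|^{1/2}`. -/
structure KreinSpace (K : Type u) [AddCommGroup K] [Module ℂ K] where
  form : K →ₗ⋆[ℂ] K →ₗ[ℂ] ℂ
  hermitian : ∀ x y, starRingEnd ℂ (form x y) = form y x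
  pos : Submodule ℂ K
  neg : Submodule ℂ K
  isCompl : IsCompl pos neg
  orthogonal : ∀ x ∈ pos, ∀ y ∈ neg, form x y = 0
  pos_def : ∀ x ∈ pos, x ≠ 0 → 0 < (form x x).re
  neg_def : ∀ x ∈ neg, x ≠ 0 → (form x x).re < 0
  complete_pos : ∀ w : ℕ → K, (∀ n, w n ∈ pos) →
    (∀ ε > 0, ∃ N, ∀ m ≥ N, ∀ n ≥ N, ‖form (w m - w n) (w m - w n)‖ < ε) →
    ∃ x ∈ pos, Tendsto (fun n => form (w n - x) (w n - x)) atTop (𝓝 0)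
  complete_neg : ∀ w : ℕ → K, (∀ n, w n ∈ neg) →
    (∀ ε > 0, ∃ N, ∀ m ≥ N, ∀ n ≥ N, ‖form (w m - w n) (w m - w n)‖ < ε) →
    ∃ x ∈ neg, Tendsto (fun n => form (w n - x) (w n - x)) atTop (𝓝 0)

namespace KreinSpace

section

variable {K : Type u} [AddCommGroup K] [Module ℂ K] (S : KreinSpace K)

/-- The fundamental symmetry `J (x₊ + x₋) = x₊ - x₋`. -/
noncomputable def J : K →ₗ[ℂ] K :=
  S.pos.projection S.neg S.isCompl - S.neg.projection S.pos S.isCompl.symm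

theorem J_of_mem_pos {x : K} (hx : x ∈ S.pos) : S.J x = x := by
  simp [J, Submodule.projection_apply_of_mem_left S.isCompl hx,
    Submodule.projection_apply_of_mem_right S.isCompl.symm hx]

theorem J_of_mem_neg {x : K} (hx : x ∈ S.neg) : S.J x = -x := by
  simp [J, Submodule.projection_apply_of_mem_left S.isCompl.symm hx,
    Submodule.projection_apply_of_mem_right S.isCompl hx]

theorem exists_decomp (x : K) : ∃ p ∈ S.pos, ∃ q ∈ S.neg, x = p + q :=
  ⟨_, Submodule.projection_apply_mem S.isCompl x, _,
    Submodule.projection_apply_mem S.isCompl.symm x,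
    (Submodule.projection_add_projection_eq_self S.isCompl x).symm⟩

theorem orthogonal' {x y : K} (hx : x ∈ S.neg) (hy : y ∈ S.pos) : S.form x y = 0 := by
  rw [← S.hermitian y x, S.orthogonal y hy x hx, map_zero]

theorem form_J_decomp {p q p' q' : K} (hp : p ∈ S.pos) (hq : q ∈ S.neg) (hp' : p' ∈ S.pos)
    (hq' : q' ∈ S.neg) : S.form (p + q) (S.J (p' + q')) = S.form p p' - S.form q q' := by
  simp [S.J_of_mem_pos hp', S.J_of_mem_neg hq', S.orthogonal p hp q' hq',
    S.orthogonal' hq hp', sub_eq_add_neg]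

theorem J_J (x : K) : S.J (S.J x) = x := by
  obtain ⟨p, hp, q, hq, rfl⟩ := S.exists_decomp x
  simp [S.J_of_mem_pos hp, S.J_of_mem_neg hq]

theorem form_self_nonneg {x : K} (hx : x ∈ S.pos) : 0 ≤ (S.form x x).re := by
  by_cases h : x = 0
  · simp [h]
  · exact (S.pos_def x hx h).le

theorem form_self_nonpos {x : K} (hx : x ∈ S.neg) : (S.form x x).re ≤ 0 := by
  by_cases h : x = 0
  · simp [h]
  · exact (S.neg_def x hx h).le

/-- The `J`-inner product `(x, y)_J = (x, J y)`. -/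
@[reducible]
noncomputable def jCore : InnerProductSpace.Core ℂ K where
  inner x y := S.form x (S.J y)
  conj_inner_symm x y := by
    obtain ⟨p, hp, q, hq, rfl⟩ := S.exists_decomp x
    obtain ⟨p', hp', q', hq', rfl⟩ := S.exists_decomp y
    rw [S.form_J_decomp hp' hq' hp hq, S.form_J_decomp hp hq hp' hq', map_sub, S.hermitian,
      S.hermitian]
  re_inner_nonneg x := by
    obtain ⟨p, hp, q, hq, rfl⟩ := S.exists_decomp x
    rw [S.form_J_decomp hp hq hp hq, map_sub]
    have h1 := S.form_self_nonneg hp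
    have h2 := S.form_self_nonpos hq
    simp only [RCLike.re_eq_complex_re]
    linarith
  add_left x y z := by simp
  smul_left x y r := by simp
  definite x hx := by
    obtain ⟨p, hp, q, hq, rfl⟩ := S.exists_decomp x
    rw [S.form_J_decomp hp hq hp hq] at hx
    have hre := congrArg Complex.re hx
    rw [Complex.sub_re, Complex.zero_re] at hre
    have h1 := S.form_self_nonneg hp
    have h2 := S.form_self_nonpos hq
    have hp0 : p = 0 := by
      by_contra h
      have := S.pos_def p hp h
      linarith
    have hq0 : q = 0 := by
      by_contra h
      have := S.neg_def q hq h
      linarith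
    rw [hp0, hq0, add_zero]

end

/-- The vector space `K` regarded as the Hilbert space `(K, (·,·)_J)`. -/
@[nolint unusedArguments]
def JSpace {K : Type u} [AddCommGroup K] [Module ℂ K] (_ : KreinSpace K) : Type u := K

section

variable {K : Type u} [AddCommGroup K] [Module ℂ K] (S : KreinSpace K)

noncomputable instance : NormedAddCommGroup S.JSpace :=
  S.jCore.toNormedAddCommGroup

noncomputable instance : InnerProductSpace ℂ S.JSpace :=
  InnerProductSpace.ofCore S.jCore.toCore

noncomputable instance : Inner ℂ S.JSpace :=
  InnerProductSpace.toInner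

/-- The indefinite inner product of the Krein space, on the elements of `S.JSpace`. -/
def bracket (x y : S.JSpace) : ℂ := S.form x y

/-- The fundamental symmetry as a linear equivalence of `(K, (·,·)_J)`. -/
noncomputable def symm : S.JSpace ≃ₗ[ℂ] S.JSpace :=
  LinearEquiv.ofInvolutive (S.J : S.JSpace →ₗ[ℂ] S.JSpace) S.J_J

theorem symm_symm_apply (x : S.JSpace) : S.symm (S.symm x) = x := S.J_J x

theorem inner_eq (x y : S.JSpace) : inner ℂ x y = S.bracket x (S.symm y) := rfl

theorem bracket_eq (x y : S.JSpace) : S.bracket x y = inner ℂ x (S.symm y) := by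
  rw [inner_eq, symm_symm_apply]

theorem inner_symm_left (x y : S.JSpace) : inner ℂ (S.symm x) y = inner ℂ x (S.symm y) := by
  rw [← inner_conj_symm (𝕜 := ℂ) (S.symm x) y, ← bracket_eq, ← bracket_eq]
  exact S.hermitian _ _

theorem norm_sq_eq (x : S.JSpace) : ‖x‖ ^ 2 = (S.form x (S.J x)).re :=
  InnerProductSpace.norm_sq_eq_re_inner (𝕜 := ℂ) x

theorem norm_form_self (x : K) : ‖S.form x x‖ = |(S.form x x).re| :=
  (Complex.abs_re_eq_norm.2 (Complex.conj_eq_iff_im.1 (S.hermitian x x))).symm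

theorem norm_sq_decomp {p q : K} (hp : p ∈ S.pos) (hq : q ∈ S.neg) :
    ‖(show S.JSpace from p + q)‖ ^ 2 = ‖S.form p p‖ + ‖S.form q q‖ := by
  rw [norm_sq_eq, S.form_J_decomp hp hq hp hq, norm_form_self, norm_form_self,
    abs_of_nonneg (S.form_self_nonneg hp), abs_of_nonpos (S.form_self_nonpos hq), Complex.sub_re,
    sub_eq_add_neg]

instance : CompleteSpace S.JSpace := by
  refine Metric.complete_of_cauchySeq_tendsto fun w hw => ?_
  choose p hp q hq hpq using fun n => S.exists_decomp (w n)
  have hsub : ∀ m n, w m - w n = (p m - p n) + (q m - q n) := fun m n =>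
    (congrArg₂ (fun x y : K => x - y) (hpq m) (hpq n)).trans (add_sub_add_comm _ _ _ _)
  have hnorm : ∀ m n, ‖w m - w n‖ ^ 2 =
      ‖S.form (p m - p n) (p m - p n)‖ + ‖S.form (q m - q n) (q m - q n)‖ := fun m n =>
    (congrArg (fun x : S.JSpace => ‖x‖ ^ 2) (hsub m n)).trans
      (S.norm_sq_decomp (S.pos.sub_mem (hp m) (hp n)) (S.neg.sub_mem (hq m) (hq n)))
  have hC : ∀ ε > 0, ∃ N, ∀ m ≥ N, ∀ n ≥ N, ‖w m - w n‖ ^ 2 < ε := by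
    intro ε hε
    obtain ⟨N, hN⟩ := Metric.cauchySeq_iff.1 hw (√ε) (Real.sqrt_pos.2 hε)
    refine ⟨N, fun m hm n hn => ?_⟩
    have := hN m hm n hn
    rw [dist_eq_norm] at this
    exact (Real.lt_sqrt (norm_nonneg _)).1 this
  obtain ⟨x, hx, hxl⟩ := S.complete_pos p hp fun ε hε => by
    obtain ⟨N, hN⟩ := hC ε hε
    refine ⟨N, fun m hm n hn => lt_of_le_of_lt ?_ (hN m hm n hn)⟩
    rw [hnorm]
    exact le_add_of_nonneg_right (norm_nonneg _)
  obtain ⟨y, hy, hyl⟩ := S.complete_neg q hq fun ε hε => by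
    obtain ⟨N, hN⟩ := hC ε hε
    refine ⟨N, fun m hm n hn => lt_of_le_of_lt ?_ (hN m hm n hn)⟩
    rw [hnorm]
    exact le_add_of_nonneg_left (norm_nonneg _)
  let z : S.JSpace := show K from x + y
  refine ⟨z, ?_⟩
  rw [tendsto_iff_norm_sub_tendsto_zero]
  have hlim : Tendsto (fun n => ‖w n - z‖ ^ 2) atTop (𝓝 0) := by
    have h0 := hxl.norm.add hyl.norm
    rw [norm_zero, add_zero] at h0
    refine h0.congr fun n => ?_
    have h1 : w n - z = (p n - x) + (q n - y) :=
      (congrArg (fun t : K => t - (x + y)) (hpq n)).trans (add_sub_add_comm _ _ _ _)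
    exact ((congrArg (fun t : S.JSpace => ‖t‖ ^ 2) h1).trans
      (S.norm_sq_decomp (S.pos.sub_mem (hp n) hx) (S.neg.sub_mem (hq n) hy))).symm
  have h2 := (Real.continuous_sqrt.tendsto 0).comp hlim
  rw [Real.sqrt_zero] at h2
  exact h2.congr fun n => Real.sqrt_sq (norm_nonneg _)

/-- The adjoint `A⁺ = J A* J` of an operator with respect to the indefinite inner product, where
`A*` is the adjoint in `(K, (·,·)_J)`; see `mem_graph_kreinAdjoint_iff`. -/
noncomputable def kreinAdjoint (A : S.JSpace →ₗ.[ℂ] S.JSpace) : S.JSpace →ₗ.[ℂ] S.JSpace where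
  domain := A.adjoint.domain.comap (S.symm : S.JSpace →ₗ[ℂ] S.JSpace)
  toFun := (S.symm : S.JSpace →ₗ[ℂ] S.JSpace) ∘ₗ A.adjoint.toFun ∘ₗ
    ((S.symm : S.JSpace →ₗ[ℂ] S.JSpace).restrict fun _ hx => hx)

/-- For densely defined `A`: `y` is in the domain of `A⁺` with `A⁺ y = z` if and only if
`(A x, y) = (x, z)` for all `x` in the domain of `A`. -/
theorem mem_graph_kreinAdjoint_iff {A : S.JSpace →ₗ.[ℂ] S.JSpace}
    (hA : Dense (A.domain : Set S.JSpace)) (y z : S.JSpace) :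
    (y, z) ∈ (S.kreinAdjoint A).graph ↔
      ∀ x : A.domain, S.bracket (A x) y = S.bracket x z := by
  have key : ∀ x : A.domain, S.bracket (A x) y = S.bracket x z ↔
      inner ℂ (S.symm z) (x : S.JSpace) = inner ℂ (S.symm y) (A x) := by
    intro x
    rw [bracket_eq, bracket_eq, ← inner_conj_symm (𝕜 := ℂ) (S.symm z),
      ← inner_conj_symm (𝕜 := ℂ) (S.symm y)]
    exact ⟨fun h => congrArg _ h.symm, fun h => ((starRingEnd ℂ).injective h).symm⟩
  simp only [key]
  rw [LinearPMap.mem_graph_iff]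
  constructor
  · rintro ⟨y', rfl, hz⟩ x
    have h := LinearPMap.adjoint_isFormalAdjoint hA ⟨S.symm y', y'.2⟩ x
    have hz' : S.kreinAdjoint A y' = z := hz
    rw [← hz']
    exact (congrArg (fun t => inner ℂ t (x : S.JSpace)) (S.symm_symm_apply _)).trans h
  · intro h
    have hd := LinearPMap.mem_adjoint_domain_of_exists (S.symm y) ⟨S.symm z, h⟩
    refine ⟨⟨y, hd⟩, rfl, ?_⟩
    have h1 := LinearPMap.adjoint_apply_eq hA ⟨S.symm y, hd⟩ h
    exact (congrArg S.symm h1).trans (S.symm_symm_apply z)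

end

end KreinSpace

section Operators

variable {H : Type u} [NormedAddCommGroup H] [InnerProductSpace ℂ H]

/-- `D` is contained in the domain of `A` and `A D ⊆ D`. -/
def IsStableUnder (D : Submodule ℂ H) (A : H →ₗ.[ℂ] H) : Prop :=
  ∀ x ∈ D, ∃ hx : x ∈ A.domain, A ⟨x, hx⟩ ∈ D

/-- `[A, B] = c I` on `D`: for `x ∈ D` the vectors `A B x` and `B A x` are defined and
`A B x - B A x = c x`. -/
def CommutatorEqOn (A B : H →ₗ.[ℂ] H) (c : ℂ) (D : Submodule ℂ H) : Prop :=
  ∀ x ∈ D, ∃ (hA : x ∈ A.domain) (hB : x ∈ B.domain) (hAB : B ⟨x, hB⟩ ∈ A.domain)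
    (hBA : A ⟨x, hA⟩ ∈ B.domain), A ⟨B ⟨x, hB⟩, hAB⟩ - B ⟨A ⟨x, hA⟩, hBA⟩ = c • x

/-- A densely defined operator whose closure is self-adjoint. -/
def IsEssentiallySelfAdjoint [CompleteSpace H] (A : H →ₗ.[ℂ] H) : Prop :=
  Dense (A.domain : Set H) ∧ A.IsClosable ∧ IsSelfAdjoint A.closure

/-- `U t = e^{itA}` for all real `t`, in the sense of Stone's theorem: `U` is a strongly
continuous one-parameter group of unitary operators with infinitesimal generator `i A`, that is,
`x ∈ dom A` and `A x = y` if and only if `t ↦ U t x` is differentiable at `0` with derivative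
`i y`. For a given densely defined `A` there is at most one such `U`, see `IsExpI.unique`. -/
structure IsExpI (A : H →ₗ.[ℂ] H) (U : ℝ → H ≃ₗᵢ[ℂ] H) : Prop where
  add : ∀ s t x, U (s + t) x = U s (U t x)
  continuous : ∀ x, Continuous fun t => U t x
  generator : ∀ x y, (x, y) ∈ A.graph ↔ HasDerivAt (fun t : ℝ => U t x) (Complex.I • y) 0

namespace IsExpI

variable {A : H →ₗ.[ℂ] H} {U V : ℝ → H ≃ₗᵢ[ℂ] H}

theorem zero (hU : IsExpI A U) (x : H) : U 0 x = x :=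
  (U 0).injective (by rw [← hU.add, add_zero])

theorem hasDerivAt (hU : IsExpI A U) {x y : H} (h : (x, y) ∈ A.graph) (t : ℝ) :
    HasDerivAt (fun s : ℝ => U s x) (Complex.I • U t y) t := by
  have h0 := (hU.generator x y).1 h
  have h1 : HasDerivAt (fun s : ℝ => U (s - t) x) (Complex.I • y) t := by
    have : HasDerivAt (fun s : ℝ => U s x) (Complex.I • y) (t - t) := by rwa [sub_self]
    exact this.comp_sub_const t t
  have h2 := ((U t).toContinuousLinearEquiv.toContinuousLinearMap.restrictScalars
    ℝ).hasFDerivAt.comp_hasDerivAt t h1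
  have h3 : (fun s : ℝ => U s x) = fun s : ℝ => U t (U (s - t) x) := by
    funext s
    rw [← hU.add, add_sub_cancel]
  rw [h3, ← map_smul]
  exact h2

theorem graph_apply (hU : IsExpI A U) {x y : H} (h : (x, y) ∈ A.graph) (t : ℝ) :
    (U t x, U t y) ∈ A.graph := by
  rw [hU.generator]
  have h1 := hU.hasDerivAt h (0 + t)
  have h2 := h1.comp_add_const 0 t
  rw [zero_add] at h2
  exact h2.congr_of_eventuallyEq (Eventually.of_forall fun s => (hU.add s t x).symm)

theorem symmetric (hU : IsExpI A U) {x y x' y' : H} (h : (x, y) ∈ A.graph)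
    (h' : (x', y') ∈ A.graph) : inner ℂ x y' = inner ℂ y x' := by
  have h1 := HasDerivAt.inner ℂ (hU.hasDerivAt h 0) (hU.hasDerivAt h' 0)
  simp only [LinearIsometryEquiv.inner_map_map, hU.zero] at h1
  have h2 := h1.unique (hasDerivAt_const 0 _)
  rw [inner_smul_left, inner_smul_right, Complex.conj_I] at h2
  have h3 : Complex.I * (inner ℂ x y' - inner ℂ y x') = 0 := by linear_combination h2
  exact sub_eq_zero.1 ((mul_eq_zero.1 h3).resolve_left Complex.I_ne_zero)

theorem unique (hA : Dense (A.domain : Set H)) (hU : IsExpI A U) (hV : IsExpI A V) : U = V := by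
  funext t
  have key : ∀ x ∈ A.domain, U t x = V t x := by
    intro x hx
    have hg : (x, A ⟨x, hx⟩) ∈ A.graph := A.mem_graph ⟨x, hx⟩
    set y := A ⟨x, hx⟩
    have hd : ∀ s : ℝ, HasDerivAt (fun s : ℝ => inner ℂ (U s x) (V s x)) 0 s := by
      intro s
      have h1 := HasDerivAt.inner ℂ (hU.hasDerivAt hg s) (hV.hasDerivAt hg s)
      have h2 := hU.symmetric (hU.graph_apply hg s) (hV.graph_apply hg s)
      refine h1.congr_deriv ?_
      rw [inner_smul_left, inner_smul_right, Complex.conj_I, h2]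
      ring
    have hc := is_const_of_deriv_eq_zero (fun s => (hd s).differentiableAt)
      (fun s => (hd s).deriv) t 0
    simp only [hU.zero, hV.zero] at hc
    rw [← sub_eq_zero, ← norm_eq_zero, ← sq_eq_zero_iff, norm_sub_sq (𝕜 := ℂ), hc,
      LinearIsometryEquiv.norm_map, LinearIsometryEquiv.norm_map, inner_self_eq_norm_sq]
    ring
  have hfun := Continuous.ext_on hA (U t).continuous (V t).continuous key
  exact LinearIsometryEquiv.ext fun x => congrFun hfun x

end IsExpI

/-- The Weyl relations `U(t) V(s) = e^{ist} V(s) U(t)`. -/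
def WeylRelations (U V : ℝ → H ≃ₗᵢ[ℂ] H) : Prop :=
  ∀ t s x, U t (V s x) = Complex.exp (Complex.I * s * t) • V s (U t x)

/-- `U, V` are unitarily equivalent to a direct sum of Schrödinger representations: some unitary
`W` from `H` onto the Hilbert sum of copies of `L²(ℝ)`, indexed by some `ι`, carries, in every
component, `U t` to the translation `f ↦ f(· + t)` and `V s` to the multiplication by `e^{isx}`.
These are `e^{itp}` and `e^{isq}` for `p f = -i f'` and `(q f)(x) = x f(x)`. -/
def IsDirectSumOfSchrodinger (U V : ℝ → H ≃ₗᵢ[ℂ] H) : Prop :=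
  ∃ (ι : Type u) (W : H ≃ₗᵢ[ℂ] lp (fun _ : ι => Lp ℂ 2 (volume : Measure ℝ)) 2),
    ∀ (x : H) (i : ι),
      (∀ t : ℝ, W (U t x) i =ᵐ[volume] fun r : ℝ => W x i (r + t)) ∧
      (∀ s : ℝ, W (V s x) i =ᵐ[volume] fun r : ℝ => Complex.exp (Complex.I * s * r) * W x i r)

end Operators

section AntiFock

variable {K : Type u} [AddCommGroup K] [Module ℂ K]

/-- `a` and its adjoint `a⁺` with respect to the indefinite inner product form an anti-Fock
representation of the canonical commutation relations on the linear manifold `D`, with eigenvectors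
`ψ n` (the vector usually written `ψ_{-(n+1)}`), and the fundamental decomposition of the Krein
space is adapted to it. -/
structure IsAntiFock (S : KreinSpace K) (a : S.JSpace →ₗ.[ℂ] S.JSpace)
    (D : Submodule ℂ S.JSpace) (ψ : ℕ → S.JSpace) : Prop where
  dense : Dense (D : Set S.JSpace)
  stable : IsStableUnder D a
  stable_adjoint : IsStableUnder D (S.kreinAdjoint a)
  ccr : CommutatorEqOn a (S.kreinAdjoint a) 1 D
  mem : ∀ n, ψ n ∈ D
  ne_zero : ψ 0 ≠ 0
  /-- `a⁺ ψ_{-1} = 0`. -/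
  antiFock : (ψ 0, 0) ∈ (S.kreinAdjoint a).graph
  /-- `ψ_{-n} = a^{n-1} ψ_{-1} / √((n-1)!)`. -/
  raise : ∀ n : ℕ, (ψ n, ((√(n + 1 : ℝ) : ℝ) : ℂ) • ψ (n + 1)) ∈ a.graph
  /-- The system of the vectors `ψ_{-n}` is complete. -/
  complete : Dense (Submodule.span ℂ (Set.range ψ) : Set S.JSpace)
  /-- Each `ψ_{-n}` lies in `K⁺` or in `K⁻`. -/
  adapted : ∀ n, (ψ n : K) ∈ S.pos ∨ (ψ n : K) ∈ S.neg

/-- `P̃ = (a⁺ + a) / (√2 i)`. -/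
noncomputable def momentum (S : KreinSpace K) (a : S.JSpace →ₗ.[ℂ] S.JSpace) :
    S.JSpace →ₗ.[ℂ] S.JSpace :=
  (1 / (((√2 : ℝ) : ℂ) * Complex.I)) • (S.kreinAdjoint a + a)

/-- `Q̃ = (a⁺ - a) / √2`. -/
noncomputable def position (S : KreinSpace K) (a : S.JSpace →ₗ.[ℂ] S.JSpace) :
    S.JSpace →ₗ.[ℂ] S.JSpace :=
  (1 / ((√2 : ℝ) : ℂ)) • (S.kreinAdjoint a - a)

end AntiFock

/-! ### Closed operators acting as ladders on a Hilbert basis -/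

section HilbertBasisGraph

variable {H : Type u} [NormedAddCommGroup H] [InnerProductSpace ℂ H]

/-! Adaptedness gives $J\psi_n=\sigma_n\psi_n$ with $\sigma_n=\pm1$. Comparing
$(a\psi_n,\psi_{n+1})$ with $(\psi_n,a^+\psi_{n+1})$, where $a^+\psi_{n+1}=-\sqrt{n+1}\,\psi_n$ by
the CCR, forces the signs to alternate and all $J$-norms to agree. So the $\psi_n$, divided by a
common norm, form a Hilbert basis $e_n$ of $(K,(\cdot,\cdot)_J)$, on which $a$ is the creation
operator and $b=a^+$ is minus the annihilation operator (`IsAntiFock.exists_ladder_basis`). The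
indefinite representation is thus a Fock representation in disguise.

A closed operator that raises or lowers a basis contains every pair whose coefficients satisfy the
ladder equations; this identifies both $b^*$ and $-\overline a$ with the same maximal operator.

In the basis $e_n$ the operators $\tilde P$ and $\tilde Q$ are Jacobi matrices with off-diagonal
entries of size $\sqrt{(n+1)/2}$. Carleman's argument (`jacobi_eq_zero`) leaves no square-summable
solution of the deficiency equations, so both are essentially self-adjoint and the span of the $e_n$
is a core (`ladder_essentiallySelfAdjoint`).

Neither Stone's theorem nor the Stone–von Neumann theorem is needed. The unitary sending $e_n$ to
the $n$th Hermite function (with sign $(-1)^n$) pulls the translations and modulations of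
$L^2(\mathbb R)$ back to $K$. Their generators have the same Jacobi matrices on the core, hence
extend the self-adjoint closures of $\tilde P$ and $\tilde Q$; being symmetric, they equal them
(`isExpI_of_core`). The Weyl relations are then those of translation and modulation, and a single
Schrödinger summand suffices. -/

theorem HilbertBasis.ext_inner (e : HilbertBasis ℕ ℂ H) {x y : H}
    (h : ∀ n, inner ℂ (e n) x = inner ℂ (e n) y) : x = y := by
  apply e.repr.injective
  ext n
  rw [e.repr_apply_apply, e.repr_apply_apply, h]

theorem HilbertBasis.tendsto_sum_range (e : HilbertBasis ℕ ℂ H) (x : H) :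
    Tendsto (fun N => ∑ n ∈ Finset.range N, inner ℂ (e n) x • e n) atTop (𝓝 x) := by
  have := (e.hasSum_repr x).tendsto_sum_nat
  simpa only [e.repr_apply_apply] using this

theorem HilbertBasis.mem_of_tendsto_sum (e : HilbertBasis ℕ ℂ H) {G : Submodule ℂ (H × H)}
    (hG : IsClosed (G : Set (H × H))) {f : ℕ → H} (hf : ∀ n, (e n, f n) ∈ G) {y z : H}
    (hz : Tendsto (fun N => ∑ n ∈ Finset.range N, inner ℂ (e n) y • f n) atTop (𝓝 z)) :
    (y, z) ∈ G := by
  refine hG.mem_of_tendsto ((e.tendsto_sum_range y).prodMk_nhds hz)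
    (Eventually.of_forall fun N => ?_)
  have : (∑ n ∈ Finset.range N, inner ℂ (e n) y • (e n, f n) : H × H) ∈ G :=
    G.sum_mem fun n _ => G.smul_mem _ (hf n)
  have heq : (∑ n ∈ Finset.range N, inner ℂ (e n) y • (e n, f n) : H × H) =
      (∑ n ∈ Finset.range N, inner ℂ (e n) y • e n, ∑ n ∈ Finset.range N, inner ℂ (e n) y • f n) := by
    ext <;> simp [Prod.fst_sum, Prod.snd_sum]
  rwa [heq] at this

/-- The image under the ladder of a partial sum of $y$ is, up to an index shift, a partial sum of
$z$. Hence the images converge automatically and closedness of `G` finishes; no domain condition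
beyond the coefficient equations is needed. -/
theorem HilbertBasis.mem_of_raising (e : HilbertBasis ℕ ℂ H) {G : Submodule ℂ (H × H)}
    (hG : IsClosed (G : Set (H × H))) {c : ℕ → ℂ} (hf : ∀ n, (e n, c n • e (n + 1)) ∈ G) {y z : H}
    (h0 : inner ℂ (e 0) z = 0) (h : ∀ n, inner ℂ (e (n + 1)) z = c n * inner ℂ (e n) y) :
    (y, z) ∈ G := by
  refine e.mem_of_tendsto_sum hG hf (((tendsto_add_atTop_iff_nat 1).2 (e.tendsto_sum_range z)).congr
    fun N => ?_)
  rw [Finset.sum_range_succ', h0, zero_smul, add_zero]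
  refine Finset.sum_congr rfl fun n _ => ?_
  rw [h, smul_smul, mul_comm]

theorem HilbertBasis.mem_of_lowering (e : HilbertBasis ℕ ℂ H) {G : Submodule ℂ (H × H)}
    (hG : IsClosed (G : Set (H × H))) {c : ℕ → ℂ} (hf0 : (e 0, 0) ∈ G)
    (hf : ∀ n, (e (n + 1), c n • e n) ∈ G) {y z : H}
    (h : ∀ n, inner ℂ (e n) z = c n * inner ℂ (e (n + 1)) y) : (y, z) ∈ G := by
  -- The image of `e 0` is zero, so `f` is the lowered sequence padded with a zero in front.
  obtain ⟨f, hf0', hf1⟩ : ∃ f : ℕ → H, f 0 = 0 ∧ ∀ n, f (n + 1) = c n • e n :=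
    ⟨fun n => Nat.casesOn n 0 fun n => c n • e n, rfl, fun _ => rfl⟩
  refine e.mem_of_tendsto_sum hG (f := f) ?_ ?_
  · rintro (_ | n)
    · rwa [hf0']
    · rw [hf1]
      exact hf n
  · refine (tendsto_add_atTop_iff_nat 1).1 ((e.tendsto_sum_range z).congr fun N => ?_)
    rw [Finset.sum_range_succ', hf0', smul_zero, add_zero]
    refine Finset.sum_congr rfl fun n _ => ?_
    rw [h, hf1, smul_smul, mul_comm]

variable [CompleteSpace H]

theorem LinearPMap.mem_graph_adjoint {T : H →ₗ.[ℂ] H} (hT : Dense (T.domain : Set H)) {y z : H} :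
    (y, z) ∈ T.adjoint.graph ↔ ∀ p ∈ T.graph, inner ℂ p.2 y = inner ℂ p.1 z := by
  rw [LinearPMap.adjoint_graph_eq_graph_adjoint hT, Submodule.mem_adjoint_iff]
  simp only [sub_eq_zero, Prod.forall]

/-- Pairing with the raised basis vectors forces the coefficient equations. Conversely the adjoint
is closed and contains the lowering pairs, so it contains every pair satisfying them: it is the
maximal lowering operator. -/
theorem LinearPMap.mem_graph_adjoint_of_raising (e : HilbertBasis ℕ ℂ H) {T : H →ₗ.[ℂ] H}
    (hT : Dense (T.domain : Set H)) {c : ℕ → ℂ} (hr : ∀ n, (e n, c n • e (n + 1)) ∈ T.graph)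
    (h0 : (e 0, 0) ∈ T.adjoint.graph)
    (hl : ∀ n, (e (n + 1), starRingEnd ℂ (c n) • e n) ∈ T.adjoint.graph) {y z : H} :
    (y, z) ∈ T.adjoint.graph ↔
      ∀ n, inner ℂ (e n) z = starRingEnd ℂ (c n) * inner ℂ (e (n + 1)) y := by
  refine ⟨fun h n => ?_, fun h => e.mem_of_lowering (LinearPMap.adjoint_isClosed hT) h0 hl h⟩
  have := (LinearPMap.mem_graph_adjoint hT).1 h _ (hr n)
  rw [← this, inner_smul_left]

theorem LinearPMap.mem_graph_adjoint_of_lowering (e : HilbertBasis ℕ ℂ H) {T : H →ₗ.[ℂ] H}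
    (hT : Dense (T.domain : Set H)) {c : ℕ → ℂ} (h0 : (e 0, 0) ∈ T.graph)
    (hl : ∀ n, (e (n + 1), c n • e n) ∈ T.graph)
    (hr : ∀ n, (e n, starRingEnd ℂ (c n) • e (n + 1)) ∈ T.adjoint.graph) {y z : H} :
    (y, z) ∈ T.adjoint.graph ↔ inner ℂ (e 0) z = 0 ∧
      ∀ n, inner ℂ (e (n + 1)) z = starRingEnd ℂ (c n) * inner ℂ (e n) y := by
  refine ⟨fun h => ⟨?_, fun n => ?_⟩,
    fun h => e.mem_of_raising (LinearPMap.adjoint_isClosed hT) hr h.1 h.2⟩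
  · simpa using ((LinearPMap.mem_graph_adjoint hT).1 h _ h0).symm
  · rw [← (LinearPMap.mem_graph_adjoint hT).1 h _ (hl n), inner_smul_left]

/-- A densely defined operator with a densely defined adjoint is closable. -/
theorem LinearPMap.isClosable_of_dense_adjoint {T : H →ₗ.[ℂ] H} (hT : Dense (T.domain : Set H))
    (hT' : Dense (T.adjoint.domain : Set H)) : T.IsClosable := by
  refine LinearPMap.isClosable_iff_exists_closed_extension.2
    ⟨T.adjoint.adjoint, LinearPMap.adjoint_isClosed hT', ?_⟩
  exact LinearPMap.IsFormalAdjoint.le_adjoint hT' (LinearPMap.adjoint_isFormalAdjoint hT)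

/-- The closure lies inside the double adjoint, where testing against the lowering pairs of the
adjoint forces the equations; closedness gives the converse. So the minimal and the maximal raising
operators coincide. -/
theorem LinearPMap.mem_graph_closure_of_raising (e : HilbertBasis ℕ ℂ H) {T : H →ₗ.[ℂ] H}
    (hT : Dense (T.domain : Set H)) (hT' : Dense (T.adjoint.domain : Set H)) {c : ℕ → ℂ}
    (hr : ∀ n, (e n, c n • e (n + 1)) ∈ T.graph) (h0 : (e 0, 0) ∈ T.adjoint.graph)
    (hl : ∀ n, (e (n + 1), starRingEnd ℂ (c n) • e n) ∈ T.adjoint.graph) {y z : H} :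
    (y, z) ∈ T.closure.graph ↔ inner ℂ (e 0) z = 0 ∧
      ∀ n, inner ℂ (e (n + 1)) z = c n * inner ℂ (e n) y := by
  have hc := LinearPMap.isClosable_of_dense_adjoint hT hT'
  have hle : T ≤ T.adjoint.adjoint :=
    LinearPMap.IsFormalAdjoint.le_adjoint hT' (LinearPMap.adjoint_isFormalAdjoint hT)
  have hle' : T.closure.graph ≤ T.adjoint.adjoint.graph := by
    rw [← hc.graph_closure_eq_closure_graph]
    exact Submodule.topologicalClosure_minimal _ (LinearPMap.le_graph_of_le hle)
      (LinearPMap.adjoint_isClosed hT')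
  have hr' : ∀ n, (e n, c n • e (n + 1)) ∈ T.closure.graph := fun n =>
    LinearPMap.le_graph_of_le T.le_closure (hr n)
  refine ⟨fun h => ?_, fun h => e.mem_of_raising hc.closure_isClosed hr' h.1 h.2⟩
  have := (LinearPMap.mem_graph_adjoint_of_lowering e hT' h0 hl
    fun n => by rw [Complex.conj_conj]; exact hle' (hr' n)).1 (hle' h)
  simpa only [Complex.conj_conj] using this

end HilbertBasisGraph

/-! ### The deficiency criterion for essential self-adjointness -/

section EssentialSelfAdjointness

variable {H : Type u} [NormedAddCommGroup H] [InnerProductSpace ℂ H]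

/-- Symmetry makes `inner ℂ y x` real, so the cross term is purely imaginary. -/
theorem norm_sq_add_smul_I {x y : H} (h : inner ℂ y x = inner ℂ x y) {s : ℂ}
    (hs : s = Complex.I ∨ s = -Complex.I) : ‖y + s • x‖ ^ 2 = ‖y‖ ^ 2 + ‖x‖ ^ 2 := by
  have him : (inner ℂ y x : ℂ).im = 0 := by
    rw [← Complex.conj_eq_iff_im, inner_conj_symm, h]
  have hn : ‖s‖ = 1 := by rcases hs with rfl | rfl <;> simp
  rw [norm_add_sq (𝕜 := ℂ), inner_smul_right, norm_smul, hn]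
  have : RCLike.re (s * inner ℂ y x) = 0 := by
    rcases hs with rfl | rfl <;> simp [him]
  rw [this]; ring

variable [CompleteSpace H]

/-- By `norm_sq_add_smul_I` the map $(x,y)\mapsto y+sx$ is bounded below on the closed relation `G`,
so its range is closed; the range is also dense by `hperp`. Working with a relation allows `G` to be
the closure of a core that is not yet known to be the graph of the closed operator. -/
theorem exists_mem_add_smul_I_eq {G : Submodule ℂ (H × H)} (hG : IsClosed (G : Set (H × H)))
    (hsym : ∀ p ∈ G, inner ℂ p.2 p.1 = inner ℂ p.1 p.2) {s : ℂ}
    (hs : s = Complex.I ∨ s = -Complex.I)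
    (hperp : ∀ y, (∀ p ∈ G, inner ℂ (p.2 + s • p.1) y = 0) → y = 0) (w : H) :
    ∃ p ∈ G, p.2 + s • p.1 = w := by
  have : CompleteSpace G := hG.completeSpace_coe
  let F : G →L[ℂ] H :=
    (ContinuousLinearMap.snd ℂ H H + s • ContinuousLinearMap.fst ℂ H H).comp G.subtypeL
  have hF : ∀ p : G, F p = p.1.2 + s • p.1.1 := fun p => rfl
  have hb : ∀ p : G, ‖p‖ ≤ ((1 : NNReal) : ℝ) * ‖F p‖ := by
    intro p
    have h1 := norm_sq_add_smul_I (hsym p.1 p.2) hs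
    rw [← hF] at h1
    rw [NNReal.coe_one, one_mul, ← Submodule.norm_coe, Prod.norm_def]
    refine max_le ?_ ?_ <;> refine abs_le_of_sq_le_sq' ?_ (norm_nonneg _) |>.2 <;>
      rw [h1] <;> nlinarith [sq_nonneg ‖p.1.1‖, sq_nonneg ‖p.1.2‖]
  have hcl : IsClosed (Set.range F) :=
    (F.antilipschitz_of_bound hb).isClosed_range F.uniformContinuous
  have : CompleteSpace (LinearMap.range F.toLinearMap) := by
    have : IsClosed (LinearMap.range F.toLinearMap : Set H) := hcl
    exact this.completeSpace_coe
  have htop : LinearMap.range F.toLinearMap = ⊤ := by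
    rw [← Submodule.orthogonal_eq_bot_iff, Submodule.eq_bot_iff]
    intro y hy
    refine hperp y fun p hp => ?_
    exact (Submodule.mem_orthogonal _ _).1 hy _ ⟨⟨p, hp⟩, rfl⟩
  obtain ⟨p, hp⟩ : w ∈ LinearMap.range F.toLinearMap := htop ▸ Submodule.mem_top
  exact ⟨p.1, p.2, hp⟩

/-- The basic criterion for essential self-adjointness, together with a core. -/
theorem essentiallySelfAdjoint_of_deficiency {T : H →ₗ.[ℂ] H} (hT : Dense (T.domain : Set H))
    (hsym : ∀ p ∈ T.graph, ∀ q ∈ T.graph, inner ℂ p.2 q.1 = inner ℂ p.1 q.2)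
    {v f : ℕ → H} (hv : ∀ n, (v n, f n) ∈ T.graph)
    (hdef : ∀ s : ℂ, s = Complex.I ∨ s = -Complex.I →
      ∀ y, (∀ n, inner ℂ (f n + s • v n) y = 0) → y = 0) :
    IsEssentiallySelfAdjoint T ∧ T.closure.graph =
      (Submodule.span ℂ (Set.range fun n => (v n, f n))).topologicalClosure := by
  set C := (Submodule.span ℂ (Set.range fun n => (v n, f n))).topologicalClosure with hC
  have hCcl : IsClosed (C : Set (H × H)) := Submodule.isClosed_topologicalClosure _
  have hvC : ∀ n, (v n, f n) ∈ C := fun n =>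
    Submodule.le_topologicalClosure _ (Submodule.subset_span ⟨n, rfl⟩)
  have hCT : ∀ G : Submodule ℂ (H × H), IsClosed (G : Set (H × H)) → T.graph ≤ G → C ≤ G := by
    intro G hG hle
    refine Submodule.topologicalClosure_minimal _ (Submodule.span_le.2 ?_) hG
    rintro _ ⟨n, rfl⟩
    exact hle (hv n)
  have hTadj : T.graph ≤ T.adjoint.graph := by
    rintro ⟨y, z⟩ hq
    exact (LinearPMap.mem_graph_adjoint hT).2 fun p hp => hsym p hp _ hq
  have hadjcl := LinearPMap.adjoint_isClosed hT
  have hCadj := hCT _ hadjcl hTadj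
  have hclos : T.IsClosable := LinearPMap.isClosable_iff_exists_closed_extension.2
    ⟨_, hadjcl, LinearPMap.le_of_le_graph hTadj⟩
  have hcl : T.closure.graph ≤ T.adjoint.graph := by
    rw [← hclos.graph_closure_eq_closure_graph]
    exact Submodule.topologicalClosure_minimal _ hTadj hadjcl
  have hCcl' : C ≤ T.closure.graph :=
    hCT _ hclos.closure_isClosed (LinearPMap.le_graph_of_le T.le_closure)
  -- The adjoint identity is a closed condition in the first pair, so it passes from `T` to its
  -- closure and hence to `C`.
  have hpair : ∀ p ∈ C, ∀ q ∈ T.adjoint.graph, inner ℂ p.2 q.1 = inner ℂ p.1 q.2 := by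
    intro p hp q hq
    have hset : IsClosed {p : H × H | inner ℂ p.2 q.1 = inner ℂ p.1 q.2} :=
      isClosed_eq (by fun_prop) (by fun_prop)
    have : closure (T.graph : Set (H × H)) ⊆ {p : H × H | inner ℂ p.2 q.1 = inner ℂ p.1 q.2} :=
      closure_minimal (fun p hp => (LinearPMap.mem_graph_adjoint hT).1 hq p hp) hset
    apply this
    have := hCcl' hp
    rw [← hclos.graph_closure_eq_closure_graph] at this
    exact this
  have hadjC : T.adjoint.graph ≤ C := by
    rintro ⟨y, z⟩ hyz
    -- Surjectivity of $C+i$ matches an adjoint pair with a pair of `C`. Their difference is an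
    -- eigenvector of the adjoint for $-i$, orthogonal to the range of $C-i$, hence zero by the
    -- other deficiency condition.
    obtain ⟨p, hp, hpw⟩ := exists_mem_add_smul_I_eq hCcl
      (fun p hp => hpair p hp p (hCadj hp)) (Or.inl rfl)
      (fun y hy => hdef _ (Or.inl rfl) y fun n => hy _ (hvC n)) (z + Complex.I • y)
    have hd : (y - p.1, z - p.2) ∈ T.adjoint.graph := T.adjoint.graph.sub_mem hyz (hCadj hp)
    have hz : z - p.2 = -(Complex.I • (y - p.1)) := by
      rw [smul_sub, neg_sub, sub_eq_sub_iff_add_eq_add, ← hpw, add_comm]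
    have h0 : y - p.1 = 0 := by
      refine hdef _ (Or.inr rfl) _ fun n => ?_
      have := hpair _ (hvC n) _ hd
      simp only [hz] at this
      rw [inner_add_left, this, inner_smul_left, inner_neg_right, inner_smul_right]
      simp
    have h1 : z - p.2 = 0 := by rw [hz, h0]; simp
    rw [sub_eq_zero] at h0 h1
    rw [h0, h1]
    exact hp
  have heq : T.closure.graph = T.adjoint.graph := le_antisymm hcl (hadjC.trans hCcl')
  have heq' : T.closure = T.adjoint := LinearPMap.eq_of_eq_graph heq
  have hd' : Dense (T.closure.domain : Set H) := hT.mono T.le_closure.1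
  refine ⟨⟨hT, hclos, ?_⟩, le_antisymm (hcl.trans hadjC) hCcl'⟩
  rw [LinearPMap.isSelfAdjoint_def]
  refine LinearPMap.eq_of_eq_graph (le_antisymm ?_ ?_)
  · rintro ⟨y, z⟩ hq
    rw [heq]
    exact (LinearPMap.mem_graph_adjoint hT).2 fun p hp =>
      (LinearPMap.mem_graph_adjoint hd').1 hq p (LinearPMap.le_graph_of_le T.le_closure hp)
  · rintro ⟨y, z⟩ hq
    refine (LinearPMap.mem_graph_adjoint hd').2 fun p hp => ?_
    exact hpair p (hadjC (hcl hp)) _ (hcl hq)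

end EssentialSelfAdjointness

/-! ### Generators of one-parameter unitary groups -/

section UnitaryGroup

variable {H : Type u} [NormedAddCommGroup H] [InnerProductSpace ℂ H] {U : ℝ → H ≃ₗᵢ[ℂ] H}

theorem hasDerivAt_unitaryGroup (hadd : ∀ s t x, U (s + t) x = U s (U t x)) {x y : H}
    (h : HasDerivAt (fun t : ℝ => U t x) y 0) (t : ℝ) :
    HasDerivAt (fun s : ℝ => U s x) (U t y) t := by
  have h1 : HasDerivAt (fun s : ℝ => U (s - t) x) y t := by
    have : HasDerivAt (fun s : ℝ => U s x) y (t - t) := by rwa [sub_self]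
    exact this.comp_sub_const t t
  have h2 := ((U t).toContinuousLinearEquiv.toContinuousLinearMap.restrictScalars
    ℝ).hasFDerivAt.comp_hasDerivAt t h1
  have h3 : (fun s : ℝ => U s x) = fun s : ℝ => U t (U (s - t) x) := by
    funext s
    rw [← hadd, add_sub_cancel]
  rw [h3]
  exact h2

theorem tendstoUniformly_unitary {x : ℕ → H} {y : H} (h : Tendsto x atTop (𝓝 y)) :
    TendstoUniformly (fun n t => U t (x n)) (fun t => U t y) atTop := by
  rw [Metric.tendstoUniformly_iff]
  intro ε hε
  filter_upwards [(Metric.tendsto_nhds.1 h) ε hε] with n hn t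
  rwa [(U t).dist_map, dist_comm]

/-- The infinitesimal generator (divided by `i`) of a one-parameter group, as a linear relation. -/
def generatorRelation (U : ℝ → H ≃ₗᵢ[ℂ] H) : Submodule ℂ (H × H) where
  carrier := {p | HasDerivAt (fun t : ℝ => U t p.1) (Complex.I • p.2) 0}
  add_mem' {p q} hp hq := by
    show HasDerivAt (fun t : ℝ => U t (p.1 + q.1)) (Complex.I • (p.2 + q.2)) 0
    simp only [map_add, smul_add]
    exact HasDerivAt.add hp hq
  zero_mem' := by simpa using hasDerivAt_const (0 : ℝ) (0 : H)
  smul_mem' c p hp := by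
    show HasDerivAt (fun t : ℝ => U t (c • p.1)) (Complex.I • c • p.2) 0
    simp only [map_smul]
    rw [smul_comm]
    exact HasDerivAt.const_smul c hp

/-- Unitarity makes orbits and their derivatives converge uniformly in $t$ when the initial data
converge, so differentiation commutes with the limit. -/
theorem isClosed_generatorRelation (hadd : ∀ s t x, U (s + t) x = U s (U t x)) :
    IsClosed (generatorRelation U : Set (H × H)) := by
  refine IsSeqClosed.isClosed fun p q hp hq => ?_
  have h0 : U 0 (Complex.I • q.2) = Complex.I • q.2 := (U 0).injective (by rw [← hadd, add_zero])
  have h1 : Tendsto (fun n => (p n).1) atTop (𝓝 q.1) := (continuous_fst.tendsto q).comp hq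
  have h2 : Tendsto (fun n => Complex.I • (p n).2) atTop (𝓝 (Complex.I • q.2)) :=
    ((continuous_snd.const_smul Complex.I).tendsto q).comp hq
  have h3 := hasDerivAt_of_tendstoUniformly (tendstoUniformly_unitary (U := U) h2)
    (Eventually.of_forall fun n t => hasDerivAt_unitaryGroup hadd (hp n) t)
    (fun t => (tendstoUniformly_unitary (U := U) h1).tendsto_at t) 0
  rwa [h0] at h3

/-- Vectors with a continuous orbit form a closed subspace, since orbits of convergent vectors
converge uniformly. -/
theorem continuous_unitaryGroup (hadd : ∀ s t x, U (s + t) x = U s (U t x)) {v f : ℕ → H}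
    (hv : Dense (Submodule.span ℂ (Set.range v) : Set H))
    (hd : ∀ n, HasDerivAt (fun t : ℝ => U t (v n)) (f n) 0) (x : H) :
    Continuous fun t => U t x := by
  let C : Submodule ℂ H :=
    { carrier := {x | Continuous fun t => U t x}
      add_mem' := fun {p q} hp hq => by
        show Continuous fun t => U t (p + q)
        simp only [map_add]
        exact Continuous.add hp hq
      zero_mem' := by simpa using continuous_const
      smul_mem' := fun c p hp => by
        show Continuous fun t => U t (c • p)
        simp only [map_smul]
        exact Continuous.const_smul hp c }
  have hC : IsClosed (C : Set H) := by
    refine IsSeqClosed.isClosed fun p q hp hq => ?_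
    exact (tendstoUniformly_unitary (U := U) hq).continuous
      (Eventually.of_forall fun n => hp n).frequently
  have hle : Submodule.span ℂ (Set.range v) ≤ C := by
    rw [Submodule.span_le]
    rintro _ ⟨n, rfl⟩
    exact continuous_iff_continuousAt.2 fun t =>
      (hasDerivAt_unitaryGroup hadd (hd n) t).continuousAt
  exact closure_minimal (s := (Submodule.span ℂ (Set.range v) : Set H)) hle hC
    (hv.closure_eq ▸ Set.mem_univ x)

/-- Differentiate the constant function $t\mapsto\langle U_tx,U_tx'\rangle$ at $0$. -/
theorem generatorRelation_symmetric (hadd : ∀ s t x, U (s + t) x = U s (U t x)) {p q : H × H}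
    (hp : p ∈ generatorRelation U) (hq : q ∈ generatorRelation U) :
    inner ℂ p.2 q.1 = inner ℂ p.1 q.2 := by
  have h0 : ∀ x, U 0 x = x := fun x => (U 0).injective (by rw [← hadd, add_zero])
  have h1 := HasDerivAt.inner ℂ (show HasDerivAt _ _ _ from hp) (show HasDerivAt _ _ _ from hq)
  simp only [LinearIsometryEquiv.inner_map_map, h0] at h1
  have h2 := h1.unique (hasDerivAt_const 0 _)
  rw [inner_smul_left, inner_smul_right, Complex.conj_I] at h2
  have h3 : Complex.I * (inner ℂ p.1 q.2 - inner ℂ p.2 q.1) = 0 := by linear_combination h2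
  exact (sub_eq_zero.1 ((mul_eq_zero.1 h3).resolve_left Complex.I_ne_zero)).symm

/-- The generator is closed and agrees with the operator on a core, so it extends the self-adjoint
closure. It is also symmetric, and a self-adjoint operator has no proper symmetric extension. -/
theorem isExpI_of_core [CompleteSpace H] {T : H →ₗ.[ℂ] H} (hT : IsEssentiallySelfAdjoint T)
    (hadd : ∀ s t x, U (s + t) x = U s (U t x)) {v f : ℕ → H}
    (hv : Dense (Submodule.span ℂ (Set.range v) : Set H))
    (hcore : T.closure.graph =
      (Submodule.span ℂ (Set.range fun n => (v n, f n))).topologicalClosure)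
    (hd : ∀ n, HasDerivAt (fun t : ℝ => U t (v n)) (Complex.I • f n) 0) :
    IsExpI T.closure U := by
  have hle : T.closure.graph ≤ generatorRelation U := by
    rw [hcore]
    refine Submodule.topologicalClosure_minimal _ (Submodule.span_le.2 ?_)
      (isClosed_generatorRelation hadd)
    rintro _ ⟨n, rfl⟩
    exact hd n
  refine ⟨hadd, continuous_unitaryGroup hadd hv hd, fun x y => ⟨fun h => hle h, fun h => ?_⟩⟩
  rw [← LinearPMap.isSelfAdjoint_def.1 hT.2.2]
  refine (LinearPMap.mem_graph_adjoint (hT.1.mono T.le_closure.1)).2 fun p hp => ?_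
  exact generatorRelation_symmetric hadd (hle hp) (q := (x, y)) h

end UnitaryGroup

/-! ### Carleman's argument for the Jacobi recurrence -/

section Jacobi

/-- Carleman's criterion for the recurrence of the position and momentum operators. -/
theorem jacobi_eq_zero {α w : ℂ} (hα : α ≠ 0) (hw : w.im ≠ 0) {y : ℕ → ℂ}
    (hy : Summable fun n => ‖y n‖ ^ 2) (h0 : α * y 1 = w * y 0)
    (h : ∀ n : ℕ, α * (√(n + 2 : ℝ) : ℝ) * y (n + 2) +
      starRingEnd ℂ α * (√(n + 1 : ℝ) : ℝ) * y n = w * y (n + 1)) (m : ℕ) : y m = 0 := by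
  -- Multiplying the recurrence by the conjugate of `y (n + 1)` and taking imaginary parts makes the
  -- off-diagonal terms telescope, as in Green's formula.
  have key : ∀ n : ℕ, (α * (√(n + 1 : ℝ) : ℝ) * y (n + 1) * starRingEnd ℂ (y n)).im =
      w.im * ∑ k ∈ Finset.range (n + 1), ‖y k‖ ^ 2 := by
    intro n
    induction n with
    | zero =>
      have : α * (√((0 : ℕ) + 1 : ℝ) : ℝ) * y (0 + 1) * starRingEnd ℂ (y 0) =
          w * (‖y 0‖ ^ 2 : ℝ) := by
        push_cast
        rw [← Complex.mul_conj']
        simp only [zero_add, Real.sqrt_one, Complex.ofReal_one, mul_one]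
        rw [h0]; ring
      rw [this, Complex.im_mul_ofReal]
      simp
    | succ n ih =>
      have h1 : α * (√((n + 1 : ℕ) + 1 : ℝ) : ℝ) * y (n + 1 + 1) * starRingEnd ℂ (y (n + 1)) =
          w * (‖y (n + 1)‖ ^ 2 : ℝ) -
            starRingEnd ℂ (α * (√(n + 1 : ℝ) : ℝ) * y (n + 1) * starRingEnd ℂ (y n)) := by
        have := h n
        have e : ((n + 1 : ℕ) + 1 : ℝ) = n + 2 := by push_cast; ring
        rw [e]
        push_cast
        rw [← Complex.mul_conj']
        simp only [map_mul, Complex.conj_conj, Complex.conj_ofReal]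
        linear_combination starRingEnd ℂ (y (n + 1)) * this
      rw [h1, Complex.sub_im, Complex.conj_im, ih, Complex.im_mul_ofReal,
        Finset.sum_range_succ _ (n + 1)]
      ring
  by_contra hm
  have hpos : 0 < |w.im| * ‖y m‖ ^ 2 :=
    mul_pos (abs_pos.2 hw) (pow_pos (norm_pos_iff.2 hm) 2)
  have hα' : 0 < ‖α‖ := norm_pos_iff.2 hα
  -- If `y m ≠ 0`, the sums in `key` stay above $|y_m|^2$ for $n\ge m$, so
  -- $\sqrt{n+1}\,|y_n||y_{n+1}|\ge\delta$.
  set δ := |w.im| * ‖y m‖ ^ 2 / ‖α‖ with hδ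
  have hδpos : 0 < δ := div_pos hpos hα'
  have hbound : ∀ n ≥ m, δ * (1 / ((n : ℝ) + 1)) ≤ ‖y n‖ ^ 2 + ‖y (n + 1)‖ ^ 2 := by
    intro n hn
    have h1 : ‖y m‖ ^ 2 ≤ ∑ k ∈ Finset.range (n + 1), ‖y k‖ ^ 2 :=
      Finset.single_le_sum (f := fun k => ‖y k‖ ^ 2) (fun _ _ => by positivity)
        (Finset.mem_range.2 (by omega))
    have h2 : |w.im| * ‖y m‖ ^ 2 ≤ ‖α‖ * √(n + 1 : ℝ) * (‖y (n + 1)‖ * ‖y n‖) := by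
      calc |w.im| * ‖y m‖ ^ 2 ≤ |w.im| * ∑ k ∈ Finset.range (n + 1), ‖y k‖ ^ 2 := by gcongr
        _ = |w.im * ∑ k ∈ Finset.range (n + 1), ‖y k‖ ^ 2| := by
          rw [abs_mul, abs_of_nonneg (a := ∑ k ∈ Finset.range (n + 1), ‖y k‖ ^ 2) (by positivity)]
        _ ≤ ‖α * (√(n + 1 : ℝ) : ℝ) * y (n + 1) * starRingEnd ℂ (y n)‖ := by
          rw [← key]; exact Complex.abs_im_le_norm _
        _ = _ := by
          rw [norm_mul, norm_mul, norm_mul, RCLike.norm_conj, Complex.norm_real,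
            Real.norm_of_nonneg (Real.sqrt_nonneg _)]
          ring
    have h3 : δ ≤ √(n + 1 : ℝ) * (‖y (n + 1)‖ * ‖y n‖) := by
      rw [hδ, div_le_iff₀ hα']
      linarith
    -- This crude bound is enough: divergence of the harmonic series already contradicts
    -- square-summability.
    have h4 : √(n + 1 : ℝ) ≤ n + 1 := by
      rw [Real.sqrt_le_left (by positivity)]
      nlinarith [(Nat.cast_nonneg n : (0 : ℝ) ≤ n)]
    have h5 : ‖y (n + 1)‖ * ‖y n‖ ≤ ‖y n‖ ^ 2 + ‖y (n + 1)‖ ^ 2 := by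
      nlinarith [sq_nonneg (‖y (n + 1)‖ - ‖y n‖), sq_nonneg ‖y n‖, sq_nonneg ‖y (n + 1)‖]
    rw [mul_one_div, div_le_iff₀ (by positivity)]
    calc δ ≤ √(n + 1 : ℝ) * (‖y (n + 1)‖ * ‖y n‖) := h3
      _ ≤ (n + 1) * (‖y n‖ ^ 2 + ‖y (n + 1)‖ ^ 2) := by gcongr
      _ = _ := mul_comm _ _
  have hs : Summable fun n : ℕ => ‖y (n + m)‖ ^ 2 + ‖y (n + m + 1)‖ ^ 2 :=
    ((summable_nat_add_iff m).2 hy).add <| by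
      have := (summable_nat_add_iff (m + 1)).2 hy
      simpa only [add_assoc] using this
  have hs2 : Summable fun n : ℕ => δ * (1 / (((n + m : ℕ) : ℝ) + 1)) :=
    Summable.of_nonneg_of_le (fun n => by positivity) (fun n => hbound (n + m) (by omega)) hs
  have hs3 : Summable fun n : ℕ => 1 / (((n + m : ℕ) : ℝ) + 1) :=
    (summable_mul_left_iff hδpos.ne').1 hs2
  have hs4 : Summable fun n : ℕ => 1 / ((n : ℝ)) := by
    refine (summable_nat_add_iff (m + 1)).1 (hs3.congr fun n => ?_)
    push_cast
    ring
  exact Real.not_summable_one_div_natCast hs4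

variable {H : Type u} [NormedAddCommGroup H] [InnerProductSpace ℂ H]

theorem HilbertBasis.summable_norm_inner_sq (e : HilbertBasis ℕ ℂ H) (y : H) :
    Summable fun n => ‖(inner ℂ (e n) y : ℂ)‖ ^ 2 := by
  have := (e.summable_inner_mul_inner y y).norm
  refine this.congr fun n => ?_
  rw [norm_mul, ← inner_conj_symm, RCLike.norm_conj, sq]

/-- The vector obtained from the `n`th basis vector by
`α · (creation) + conj α · (annihilation)`. -/
noncomputable def jacobiVector (e : ℕ → H) (α : ℂ) : ℕ → H
  | 0 => α • e 1
  | n + 1 => (α * (√(n + 2 : ℝ) : ℝ)) • e (n + 2) + (starRingEnd ℂ α * (√(n + 1 : ℝ) : ℝ)) • e n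

/-- Orthogonality to the range of the shifted Jacobi matrix is the three-term recurrence for the
coefficients of `y`, with a non-real spectral parameter. -/
theorem jacobi_deficiency (e : HilbertBasis ℕ ℂ H) {α : ℂ} (hα : α ≠ 0) {s : ℂ}
    (hs : s = Complex.I ∨ s = -Complex.I) (y : H)
    (hy : ∀ n, inner ℂ (jacobiVector e α n + s • e n) y = 0) : y = 0 := by
  refine e.ext_inner fun n => ?_
  rw [inner_zero_right]
  refine jacobi_eq_zero (α := starRingEnd ℂ α) (w := -starRingEnd ℂ s)
    (y := fun n => inner ℂ (e n) y) (by simpa using hα) ?_ (e.summable_norm_inner_sq y) ?_ ?_ n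
  · rcases hs with rfl | rfl <;> simp
  · have := hy 0
    rw [jacobiVector, inner_add_left, inner_smul_left, inner_smul_left] at this
    linear_combination this
  · intro n
    have := hy (n + 1)
    rw [jacobiVector, inner_add_left, inner_add_left, inner_smul_left, inner_smul_left,
      inner_smul_left] at this
    simp only [map_mul, Complex.conj_conj, Complex.conj_ofReal] at this ⊢
    linear_combination this

end Jacobi

/-! ### Fourier injectivity, translations and modulations on the line -/

section RealLine

open scoped FourierTransform ContDiff SchwartzMap

/-- Injectivity of the Fourier transform on `L¹(ℝ)`. -/
theorem ae_eq_zero_of_fourier_eq_zero {g : ℝ → ℂ} (hg : Integrable g) (h : ∀ ξ, 𝓕 g ξ = 0) :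
    ∀ᵐ x, g x = 0 := by
  refine ae_eq_zero_of_integral_contDiff_smul_eq_zero hg.locallyIntegrable fun φ hφ hφc => ?_
  have hc : HasCompactSupport (Complex.ofRealCLM ∘ φ) := hφc.comp_left rfl
  have hs : ContDiff ℝ ∞ (Complex.ofRealCLM ∘ φ) := by fun_prop
  let Φ : 𝓢(ℝ, ℂ) := hc.toSchwartzMap hs
  -- The test function is written as the Fourier transform of a Schwartz function, and the transform
  -- is then moved onto `g`.
  have h1 : ∫ ξ, 𝓕 (⇑(𝓕⁻ Φ : 𝓢(ℝ, ℂ))) ξ • g ξ = ∫ x, (𝓕⁻ Φ : 𝓢(ℝ, ℂ)) x • 𝓕 g x := by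
    simpa only [flip_innerₗ] using! VectorFourier.integral_fourierIntegral_smul_eq_flip (L := innerₗ ℝ)
      Real.continuous_fourierChar continuous_inner ((𝓕⁻ Φ : 𝓢(ℝ, ℂ)).integrable (μ := volume)) hg
  simp only [h, smul_zero, integral_zero, ← SchwartzMap.fourier_coe,
    FourierTransform.fourier_fourierInv_eq] at h1
  rw [← h1]
  rfl

theorem ae_comp_add_right {p : ℝ → Prop} (t : ℝ) (h : ∀ᵐ r, p r) : ∀ᵐ r : ℝ, p (r + t) :=
  (measurePreserving_add_right volume t).quasiMeasurePreserving.ae h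

/-- Translation on `L²(ℝ)`, as a linear isometry. -/
noncomputable def translationₗᵢ (t : ℝ) :
    Lp ℂ 2 (volume : Measure ℝ) →ₗᵢ[ℂ] Lp ℂ 2 (volume : Measure ℝ) :=
  Lp.compMeasurePreservingₗᵢ ℂ (· + t) (measurePreserving_add_right volume t)

theorem translationₗᵢ_ae (t : ℝ) (f : Lp ℂ 2 (volume : Measure ℝ)) :
    translationₗᵢ t f =ᵐ[volume] fun r => f (r + t) :=
  Lp.coeFn_compMeasurePreserving f (measurePreserving_add_right volume t)

theorem translationₗᵢ_add (s t : ℝ) (f : Lp ℂ 2 (volume : Measure ℝ)) :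
    translationₗᵢ (s + t) f = translationₗᵢ s (translationₗᵢ t f) := by
  refine Lp.ext ?_
  filter_upwards [translationₗᵢ_ae (s + t) f, translationₗᵢ_ae s (translationₗᵢ t f),
    ae_comp_add_right s (translationₗᵢ_ae t f)] with r h1 h2 h3
  rw [h1, h2, h3, add_assoc]

theorem translationₗᵢ_zero (f : Lp ℂ 2 (volume : Measure ℝ)) : translationₗᵢ 0 f = f := by
  refine Lp.ext ?_
  filter_upwards [translationₗᵢ_ae 0 f] with r h1
  rw [h1, add_zero]

/-- Translation on `L²(ℝ)`. -/
noncomputable def translation (t : ℝ) :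
    Lp ℂ 2 (volume : Measure ℝ) ≃ₗᵢ[ℂ] Lp ℂ 2 (volume : Measure ℝ) where
  toFun := translationₗᵢ t
  map_add' := map_add _
  map_smul' := map_smul _
  invFun := translationₗᵢ (-t)
  left_inv f := by rw [← translationₗᵢ_add, neg_add_cancel, translationₗᵢ_zero]
  right_inv f := by rw [← translationₗᵢ_add, add_neg_cancel, translationₗᵢ_zero]
  norm_map' f := LinearIsometry.norm_map _ f

theorem translation_ae (t : ℝ) (f : Lp ℂ 2 (volume : Measure ℝ)) :
    translation t f =ᵐ[volume] fun r => f (r + t) :=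
  translationₗᵢ_ae t f

theorem translation_add (s t : ℝ) (f : Lp ℂ 2 (volume : Measure ℝ)) :
    translation (s + t) f = translation s (translation t f) :=
  translationₗᵢ_add s t f

theorem memLp_modulation (s : ℝ) (f : Lp ℂ 2 (volume : Measure ℝ)) :
    MemLp (fun r : ℝ => Complex.exp (Complex.I * s * r) * f r) 2 volume := by
  refine (Lp.memLp f).of_le ?_ (Eventually.of_forall fun r => ?_)
  · exact (Continuous.aestronglyMeasurable (by fun_prop)).mul (Lp.aestronglyMeasurable f)
  · rw [norm_mul, mul_assoc, mul_comm Complex.I, ← Complex.ofReal_mul,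
      Complex.norm_exp_ofReal_mul_I, one_mul]

/-- Multiplication by the character `e^{isx}` on `L²(ℝ)`, as a linear isometry. -/
noncomputable def modulationₗᵢ (s : ℝ) :
    Lp ℂ 2 (volume : Measure ℝ) →ₗᵢ[ℂ] Lp ℂ 2 (volume : Measure ℝ) where
  toFun f := (memLp_modulation s f).toLp
  map_add' f g := by
    refine Lp.ext ?_
    filter_upwards [(memLp_modulation s (f + g)).coeFn_toLp, (memLp_modulation s f).coeFn_toLp,
      (memLp_modulation s g).coeFn_toLp, Lp.coeFn_add f g, Lp.coeFn_add
        (memLp_modulation s f).toLp (memLp_modulation s g).toLp] with r h1 h2 h3 h4 h5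
    rw [h1, h5, Pi.add_apply, h2, h3, h4, Pi.add_apply, mul_add]
  map_smul' c f := by
    refine Lp.ext ?_
    filter_upwards [(memLp_modulation s (c • f)).coeFn_toLp, (memLp_modulation s f).coeFn_toLp,
      Lp.coeFn_smul c f, Lp.coeFn_smul c (memLp_modulation s f).toLp] with r h1 h2 h3 h4
    rw [RingHom.id_apply, h1, h4, Pi.smul_apply, h2, h3, Pi.smul_apply, mul_smul_comm]
  norm_map' f := by
    refine le_antisymm (Lp.norm_le_norm_of_ae_le ?_) (Lp.norm_le_norm_of_ae_le ?_) <;>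
      filter_upwards [(memLp_modulation s f).coeFn_toLp] with r h1 <;>
      refine le_of_eq ?_ <;>
      simp only [LinearMap.coe_mk, AddHom.coe_mk, h1, norm_mul] <;>
      rw [mul_assoc, mul_comm Complex.I, ← Complex.ofReal_mul, Complex.norm_exp_ofReal_mul_I,
        one_mul]

theorem modulationₗᵢ_ae (s : ℝ) (f : Lp ℂ 2 (volume : Measure ℝ)) :
    modulationₗᵢ s f =ᵐ[volume] fun r : ℝ => Complex.exp (Complex.I * s * r) * f r :=
  (memLp_modulation s f).coeFn_toLp

theorem modulationₗᵢ_add (s t : ℝ) (f : Lp ℂ 2 (volume : Measure ℝ)) :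
    modulationₗᵢ (s + t) f = modulationₗᵢ s (modulationₗᵢ t f) := by
  refine Lp.ext ?_
  filter_upwards [modulationₗᵢ_ae (s + t) f, modulationₗᵢ_ae s (modulationₗᵢ t f),
    modulationₗᵢ_ae t f] with r h1 h2 h3
  rw [h1, h2, h3, ← mul_assoc, ← Complex.exp_add]
  push_cast
  ring_nf

theorem modulationₗᵢ_zero (f : Lp ℂ 2 (volume : Measure ℝ)) : modulationₗᵢ 0 f = f := by
  refine Lp.ext ?_
  filter_upwards [modulationₗᵢ_ae 0 f] with r h1
  simp [h1]

/-- Multiplication by the character `e^{isx}` on `L²(ℝ)`. -/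
noncomputable def modulation (s : ℝ) :
    Lp ℂ 2 (volume : Measure ℝ) ≃ₗᵢ[ℂ] Lp ℂ 2 (volume : Measure ℝ) where
  toFun := modulationₗᵢ s
  map_add' := map_add _
  map_smul' := map_smul _
  invFun := modulationₗᵢ (-s)
  left_inv f := by rw [← modulationₗᵢ_add, neg_add_cancel, modulationₗᵢ_zero]
  right_inv f := by rw [← modulationₗᵢ_add, add_neg_cancel, modulationₗᵢ_zero]
  norm_map' f := LinearIsometry.norm_map _ f

theorem modulation_ae (s : ℝ) (f : Lp ℂ 2 (volume : Measure ℝ)) :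
    modulation s f =ᵐ[volume] fun r : ℝ => Complex.exp (Complex.I * s * r) * f r :=
  modulationₗᵢ_ae s f

theorem modulation_add (s t : ℝ) (f : Lp ℂ 2 (volume : Measure ℝ)) :
    modulation (s + t) f = modulation s (modulation t f) :=
  modulationₗᵢ_add s t f

theorem translation_modulation (t s : ℝ) (f : Lp ℂ 2 (volume : Measure ℝ)) :
    translation t (modulation s f) =
      Complex.exp (Complex.I * s * t) • modulation s (translation t f) := by
  refine Lp.ext ?_
  filter_upwards [translation_ae t (modulation s f), ae_comp_add_right t (modulation_ae s f),
    Lp.coeFn_smul (Complex.exp (Complex.I * s * t)) (modulation s (translation t f)),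
    modulation_ae s (translation t f), translation_ae t f] with r h1 h2 h3 h4 h5
  rw [h1, h2, h3, Pi.smul_apply, h4, h5, smul_eq_mul, ← mul_assoc, ← Complex.exp_add]
  push_cast
  ring_nf

/-- A pointwise second-order remainder with a square-integrable majorant is $O(t^2)$ in norm, hence
$o(t)$. -/
theorem hasDerivAt_Lp_of_bound {F : ℝ → Lp ℂ 2 (volume : Measure ℝ)}
    {F' : Lp ℂ 2 (volume : Measure ℝ)} {g : ℝ → ℝ} (hg : MemLp g 2 volume)
    (h : ∀ t : ℝ, |t| ≤ 1 → ∀ᵐ x, ‖F t x - F 0 x - t * F' x‖ ≤ t ^ 2 * g x) :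
    HasDerivAt F F' 0 := by
  rw [hasDerivAt_iff_isLittleO_nhds_zero]
  have hO : (fun t : ℝ => F (0 + t) - F 0 - t • F') =O[𝓝 0] fun t : ℝ => t ^ 2 := by
    refine Asymptotics.IsBigO.of_bound ‖hg.toLp‖ ?_
    filter_upwards [Metric.closedBall_mem_nhds (0 : ℝ) one_pos] with t ht
    rw [zero_add, mul_comm]
    refine Lp.norm_le_mul_norm_of_ae_le_mul ?_
    filter_upwards [h t (by simpa using ht), hg.coeFn_toLp, Lp.coeFn_sub (F t - F 0) (t • F'),
      Lp.coeFn_sub (F t) (F 0), Lp.coeFn_smul t F'] with x h1 h2 h3 h4 h5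
    rw [h3, Pi.sub_apply, h4, Pi.sub_apply, h5, Pi.smul_apply, h2, Complex.real_smul]
    refine h1.trans ?_
    rw [Real.norm_of_nonneg (sq_nonneg t)]
    gcongr
    exact le_abs_self _
  exact hO.trans_isLittleO (by simpa using Asymptotics.isLittleO_pow_id (𝕜 := ℝ) one_lt_two)

/-- The mean value inequality applied twice. The factor $1/2$ is lost, which is harmless here. -/
theorem norm_taylor_le {E : Type*} [NormedAddCommGroup E] [NormedSpace ℝ E] {f f' f'' : ℝ → E}
    (hf : ∀ x, HasDerivAt f (f' x) x) (hf' : ∀ x, HasDerivAt f' (f'' x) x) {t M : ℝ}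
    (hM : ∀ u, |u| ≤ |t| → ‖f'' u‖ ≤ M) : ‖f t - f 0 - t • f' 0‖ ≤ t ^ 2 * M := by
  have hconv : Convex ℝ (Metric.closedBall (0 : ℝ) |t|) := convex_closedBall _ _
  have h0 : (0 : ℝ) ∈ Metric.closedBall (0 : ℝ) |t| := by simp
  have ht : t ∈ Metric.closedBall (0 : ℝ) |t| := by simp
  have hM0 : 0 ≤ M := (norm_nonneg _).trans (hM 0 (by simp))
  have h1 : ∀ u ∈ Metric.closedBall (0 : ℝ) |t|, ‖f' u - f' 0‖ ≤ M * |t| := by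
    intro u hu
    have := hconv.norm_image_sub_le_of_norm_hasDerivWithin_le
      (fun x hx => (hf' x).hasDerivWithinAt) (fun x hx => hM x (by simpa using hx)) h0 hu
    refine this.trans ?_
    gcongr
    simpa using hu
  have h2 := hconv.norm_image_sub_le_of_norm_hasDerivWithin_le (f := fun u => f u - u • f' 0)
    (f' := fun u => f' u - f' 0)
    (fun x hx => ((hf x).sub (by simpa using (hasDerivAt_id x).smul_const (f' 0))).hasDerivWithinAt)
    h1 h0 ht
  calc ‖f t - f 0 - t • f' 0‖ = ‖f t - t • f' 0 - (f 0 - (0 : ℝ) • f' 0)‖ := by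
        rw [zero_smul, sub_zero]; congr 1; abel
    _ ≤ M * |t| * ‖t - 0‖ := h2
    _ = t ^ 2 * M := by rw [sub_zero, Real.norm_eq_abs, ← sq_abs]; ring

/-- A normed space is isometric to the Hilbert sum of one copy of it. -/
noncomputable def lpPUnit (E : Type*) [NormedAddCommGroup E] [NormedSpace ℂ E] :
    E ≃ₗᵢ[ℂ] lp (fun _ : PUnit.{u + 1} => E) 2 where
  toFun x := ⟨fun _ => x, memℓp_gen (Summable.of_finite)⟩
  map_add' _ _ := rfl
  map_smul' _ _ := rfl
  invFun f := f PUnit.unit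
  left_inv _ := rfl
  right_inv _ := by ext; rfl
  norm_map' x := by
    have h : (0 : ℝ) < (2 : ENNReal).toReal := by simp
    rw [lp.norm_eq_tsum_rpow h, tsum_fintype, Finset.univ_unique, Finset.sum_singleton,
      ← Real.rpow_mul (norm_nonneg _), mul_one_div_cancel h.ne', Real.rpow_one]
    rfl

end RealLine

/-! ### Orthonormality from ladder relations -/

section Orthonormal

variable {H : Type u} [NormedAddCommGroup H] [InnerProductSpace ℂ H]

/-- The relation `h` descends along diagonals from $(n+1,m+1)$ to $(n,m)$, so the Gram matrix is
determined by its zeroth row and column. It serves both the Hermite functions and the vectors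
$\psi_{-n}$. -/
theorem orthonormal_of_ladder {v : ℕ → H} (hv : v 0 ≠ 0) (h0 : ∀ n, inner ℂ (v (n + 1)) (v 0) = 0)
    (h : ∀ n m : ℕ, ((√(n + 1 : ℝ) : ℝ) : ℂ) * inner ℂ (v (n + 1)) (v (m + 1)) =
      ((√(m + 1 : ℝ) : ℝ) : ℂ) * inner ℂ (v n) (v m)) :
    Orthonormal ℂ fun n => ((‖v 0‖⁻¹ : ℝ) : ℂ) • v n := by
  have hs : ∀ n : ℕ, ((√(n + 1 : ℝ) : ℝ) : ℂ) ≠ 0 := fun n => by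
    rw [Complex.ofReal_ne_zero]
    positivity
  have key : ∀ n m, inner ℂ (v n) (v m) = if n = m then ((‖v 0‖ ^ 2 : ℝ) : ℂ) else 0 := by
    intro n
    induction n with
    | zero =>
      rintro (_ | m)
      · rw [inner_self_eq_norm_sq_to_K]
        simp
      · rw [← inner_conj_symm, h0]
        simp
    | succ n ih =>
      rintro (_ | m)
      · rw [h0]
        simp
      · apply mul_left_cancel₀ (hs n)
        rw [h, ih]
        by_cases hnm : n = m <;> simp [hnm]
  have hn : ((‖v 0‖ : ℝ) : ℂ) ≠ 0 := by simpa using hv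
  rw [orthonormal_iff_ite]
  intro n m
  rw [inner_smul_left, inner_smul_right, key, Complex.conj_ofReal]
  split_ifs
  · push_cast
    field_simp
  · simp

end Orthonormal

/-! ### Polynomials times a Gaussian: derivatives and completeness -/

section Hermite

open Polynomial

theorem abs_pow_le_exp (n : ℕ) : ∃ C : ℝ, 0 ≤ C ∧ ∀ x : ℝ, |x| ^ n ≤ C * Real.exp (x ^ 2 / 4) := by
  -- From $|x|^n\le1+x^{2n}$ and the $n$th term of the series of $e^{x^2/4}$.
  refine ⟨1 + 4 ^ n * n.factorial, by positivity, fun x => ?_⟩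
  have h1 : |x| ^ n ≤ 1 + (x ^ 2) ^ n := by
    rw [← sq_abs, ← pow_mul, mul_comm 2 n, pow_mul]
    nlinarith [sq_nonneg (|x| ^ n - 1), sq_nonneg (|x| ^ n)]
  have h2 := Real.pow_div_factorial_le_exp (x ^ 2 / 4) (by positivity) n
  rw [div_le_iff₀ (by positivity), div_pow, div_le_iff₀ (by positivity)] at h2
  have h3 : 1 ≤ Real.exp (x ^ 2 / 4) := Real.one_le_exp (by positivity)
  nlinarith

theorem Polynomial.abs_eval_le_exp (p : ℝ[X]) :
    ∃ C : ℝ, 0 ≤ C ∧ ∀ x : ℝ, |p.eval x| ≤ C * Real.exp (x ^ 2 / 4) := by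
  induction p using Polynomial.induction_on' with
  | add p q hp hq =>
    obtain ⟨C, hC, h⟩ := hp
    obtain ⟨C', hC', h'⟩ := hq
    refine ⟨C + C', by positivity, fun x => ?_⟩
    rw [eval_add, add_mul]
    exact (abs_add_le _ _).trans (add_le_add (h x) (h' x))
  | monomial n a =>
    obtain ⟨C, hC, h⟩ := abs_pow_le_exp n
    refine ⟨|a| * C, by positivity, fun x => ?_⟩
    rw [eval_monomial, abs_mul, abs_pow, mul_assoc]
    gcongr
    exact h x

/-- The function `p(x) e^{-x²/2}`. -/
noncomputable def polyGauss (p : ℝ[X]) (x : ℝ) : ℝ := p.eval x * Real.exp (-(x ^ 2) / 2)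

theorem abs_polyGauss_le (p : ℝ[X]) :
    ∃ C : ℝ, 0 ≤ C ∧ ∀ x : ℝ, |polyGauss p x| ≤ C * Real.exp (-(x ^ 2) / 4) := by
  obtain ⟨C, hC, h⟩ := p.abs_eval_le_exp
  refine ⟨C, hC, fun x => ?_⟩
  rw [polyGauss, abs_mul, Real.abs_exp]
  calc |p.eval x| * Real.exp (-(x ^ 2) / 2)
      ≤ C * Real.exp (x ^ 2 / 4) * Real.exp (-(x ^ 2) / 2) := by gcongr; exact h x
    _ = _ := by rw [mul_assoc, ← Real.exp_add]; ring_nf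

theorem memLp_exp_neg_sq {b : ℝ} (hb : 0 < b) :
    MemLp (fun x : ℝ => Real.exp (-b * x ^ 2)) 2 volume := by
  rw [memLp_two_iff_integrable_sq (Continuous.aestronglyMeasurable (by fun_prop))]
  refine (integrable_exp_neg_mul_sq (b := 2 * b) (by positivity)).congr
    (Eventually.of_forall fun x => ?_)
  simp only [← Real.exp_nat_mul]
  push_cast
  ring_nf

theorem polyGauss_X_mul (p : ℝ[X]) (x : ℝ) : polyGauss (X * p) x = x * polyGauss p x := by
  rw [polyGauss, polyGauss, eval_mul, eval_X, mul_assoc]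

theorem continuous_polyGauss (p : ℝ[X]) : Continuous (polyGauss p) := by
  unfold polyGauss
  fun_prop

theorem memLp_polyGauss (p : ℝ[X]) : MemLp (polyGauss p) 2 volume := by
  obtain ⟨C, hC, h⟩ := abs_polyGauss_le p
  refine ((memLp_exp_neg_sq (b := 1 / 4) (by norm_num)).const_mul C).of_le
    (continuous_polyGauss p).aestronglyMeasurable (Eventually.of_forall fun x => ?_)
  rw [Real.norm_eq_abs, Real.norm_of_nonneg (by positivity)]
  convert h x using 3
  ring

/-- The element `p(x) e^{-x²/2}` of `L²(ℝ)`. -/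
noncomputable def hermiteLp (p : ℝ[X]) : Lp ℂ 2 (volume : Measure ℝ) :=
  (memLp_polyGauss p).ofReal.toLp (fun x => (polyGauss p x : ℂ))

theorem hermiteLp_ae (p : ℝ[X]) : hermiteLp p =ᵐ[volume] fun x => (polyGauss p x : ℂ) :=
  MemLp.coeFn_toLp _

theorem hermiteLp_add (p q : ℝ[X]) : hermiteLp (p + q) = hermiteLp p + hermiteLp q := by
  refine Lp.ext ?_
  filter_upwards [hermiteLp_ae (p + q), hermiteLp_ae p, hermiteLp_ae q,
    Lp.coeFn_add (hermiteLp p) (hermiteLp q)] with x h1 h2 h3 h4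
  rw [h1, h4, Pi.add_apply, h2, h3, polyGauss, polyGauss, polyGauss, eval_add]
  push_cast
  ring

theorem hermiteLp_C_mul (c : ℝ) (p : ℝ[X]) : hermiteLp (C c * p) = (c : ℂ) • hermiteLp p := by
  refine Lp.ext ?_
  filter_upwards [hermiteLp_ae (C c * p), hermiteLp_ae p,
    Lp.coeFn_smul (c : ℂ) (hermiteLp p)] with x h1 h2 h3
  rw [h1, h3, Pi.smul_apply, h2, polyGauss, polyGauss, eval_mul, eval_C, smul_eq_mul]
  push_cast
  ring

theorem hermiteLp_sub (p q : ℝ[X]) : hermiteLp (p - q) = hermiteLp p - hermiteLp q := by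
  rw [eq_sub_iff_add_eq, ← hermiteLp_add, sub_add_cancel]

theorem hermiteLp_zero : hermiteLp 0 = 0 := by
  simpa using hermiteLp_sub 0 0

theorem hasDerivAt_polyGauss (p : ℝ[X]) (x : ℝ) :
    HasDerivAt (polyGauss p) (polyGauss (derivative p - X * p) x) x := by
  have h1 : HasDerivAt (fun x : ℝ => -(x ^ 2) / 2) (-x) x := by
    have := ((hasDerivAt_pow 2 x).neg).div_const 2
    refine this.congr_deriv ?_
    simp
    ring
  refine ((p.hasDerivAt x).mul h1.exp).congr_deriv ?_
  simp only [polyGauss, eval_sub, eval_mul, eval_X]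
  ring

theorem integrable_polyGauss_mul (p q : ℝ[X]) :
    Integrable fun x => polyGauss p x * polyGauss q x :=
  (memLp_polyGauss p).integrable_mul (memLp_polyGauss q)

theorem inner_hermiteLp (p q : ℝ[X]) :
    inner ℂ (hermiteLp p) (hermiteLp q) = ((∫ x, polyGauss p x * polyGauss q x : ℝ) : ℂ) := by
  rw [L2.inner_def, ← integral_complex_ofReal]
  refine integral_congr_ae ?_
  filter_upwards [hermiteLp_ae p, hermiteLp_ae q] with x h1 h2
  rw [h1, h2, RCLike.inner_apply, Complex.conj_ofReal]
  push_cast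
  ring

/-- On $pe^{-x^2/2}$ the operator $d/dx-x$ acts as $p\mapsto p'-2xp$ and $d/dx+x$ as $p\mapsto p'$.
Integration by parts makes them negative adjoints of each other. -/
theorem inner_hermiteLp_raise (p q : ℝ[X]) :
    inner ℂ (hermiteLp (derivative p - 2 * X * p)) (hermiteLp q) =
      -inner ℂ (hermiteLp p) (hermiteLp (derivative q)) := by
  have h0 : ∫ x, (polyGauss (derivative p - X * p) x * polyGauss q x +
      polyGauss p x * polyGauss (derivative q - X * q) x) = 0 :=
    integral_eq_zero_of_hasDerivAt_of_integrable
      (fun x => (hasDerivAt_polyGauss p x).mul (hasDerivAt_polyGauss q x))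
      ((integrable_polyGauss_mul _ _).add (integrable_polyGauss_mul _ _))
      (integrable_polyGauss_mul p q)
  rw [inner_hermiteLp, inner_hermiteLp, ← Complex.ofReal_neg, Complex.ofReal_inj,
    eq_neg_iff_add_eq_zero, ← integral_add (integrable_polyGauss_mul _ _)
    (integrable_polyGauss_mul _ _), ← h0]
  congr 1
  funext x
  simp only [polyGauss, eval_sub, eval_mul, eval_X, eval_ofNat]
  ring

theorem hasDerivAt_translation_hermiteLp (p : ℝ[X]) :
    HasDerivAt (fun t => translation t (hermiteLp p)) (hermiteLp (derivative p - X * p)) 0 := by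
  set p₁ := derivative p - X * p
  obtain ⟨C, hC, hb⟩ := abs_polyGauss_le (derivative p₁ - X * p₁)
  -- The majorant must be uniform over shifts $|u|\le1$: $-(x+u)^2/4\le 1/4-x^2/8$, because
  -- $(x+2u)^2\ge0$.
  refine hasDerivAt_Lp_of_bound
    ((memLp_exp_neg_sq (b := 1 / 8) (by norm_num)).const_mul (C * Real.exp (1 / 4))) fun t ht => ?_
  filter_upwards [translation_ae t (hermiteLp p), ae_comp_add_right t (hermiteLp_ae p),
    translation_ae 0 (hermiteLp p), ae_comp_add_right 0 (hermiteLp_ae p), hermiteLp_ae p₁]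
    with x h1 h2 h3 h4 h5
  rw [h1, h2, h3, h4, h5, ← Complex.ofReal_mul, ← Complex.ofReal_sub, ← Complex.ofReal_sub,
    Complex.norm_real]
  have h := norm_taylor_le (f := fun s => polyGauss p (x + s)) (f' := fun s => polyGauss p₁ (x + s))
    (f'' := fun s => polyGauss (derivative p₁ - X * p₁) (x + s))
    (fun s => (hasDerivAt_polyGauss p (x + s)).comp_const_add x s)
    (fun s => (hasDerivAt_polyGauss p₁ (x + s)).comp_const_add x s) (t := t)
    (M := C * Real.exp (1 / 4) * Real.exp (-(1 / 8) * x ^ 2)) ?_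
  · simpa only [add_zero, smul_eq_mul] using h
  · intro u hu
    refine (hb (x + u)).trans ?_
    rw [mul_assoc, ← Real.exp_add]
    gcongr
    have : u ^ 2 ≤ 1 := by
      rw [← sq_abs]
      exact pow_le_one₀ (abs_nonneg u) (hu.trans ht)
    nlinarith [sq_nonneg (x + 2 * u)]

theorem hasDerivAt_modulation_hermiteLp (p : ℝ[X]) :
    HasDerivAt (fun s => modulation s (hermiteLp p)) (Complex.I • hermiteLp (X * p)) 0 := by
  -- The second derivative in $s$ is $-x^2e^{isx}p(x)e^{-x^2/2}$, whose modulus does not depend on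
  -- $s$.
  refine hasDerivAt_Lp_of_bound (memLp_polyGauss (X * (X * p))).norm fun t ht => ?_
  filter_upwards [modulation_ae t (hermiteLp p), modulation_ae 0 (hermiteLp p), hermiteLp_ae p,
    hermiteLp_ae (X * p), Lp.coeFn_smul Complex.I (hermiteLp (X * p))] with x h1 h2 h3 h4 h5
  rw [h1, h2, h3, h5, Pi.smul_apply, h4]
  have hexp : ∀ c : ℂ, ∀ s : ℝ, HasDerivAt (fun s : ℝ => Complex.exp (Complex.I * s * x) * c)
      (Complex.exp (Complex.I * s * x) * (Complex.I * x * c)) s := by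
    intro c s
    have h0 : HasDerivAt (fun s : ℝ => Complex.I * (s : ℂ) * x) (Complex.I * x) s := by
      simpa using ((Complex.ofRealCLM.hasDerivAt (x := s)).const_mul Complex.I).mul_const (x : ℂ)
    exact (h0.cexp.mul_const c).congr_deriv (by ring)
  have h := norm_taylor_le (hexp (polyGauss p x)) (hexp (Complex.I * x * polyGauss p x)) (t := t)
    (M := ‖polyGauss (X * (X * p)) x‖) ?_
  · have h0 : t • (Complex.exp (Complex.I * (0 : ℝ) * x) * (Complex.I * x * polyGauss p x)) =
        t * (Complex.I • (polyGauss (X * p) x : ℂ)) := by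
      rw [polyGauss_X_mul, Complex.real_smul, Complex.ofReal_zero, mul_zero, zero_mul,
        Complex.exp_zero, smul_eq_mul]
      push_cast
      ring
    rwa [h0] at h
  · intro u hu
    rw [norm_mul, mul_assoc Complex.I, mul_comm Complex.I, ← Complex.ofReal_mul,
      Complex.norm_exp_ofReal_mul_I, one_mul]
    rw [polyGauss_X_mul, polyGauss_X_mul]
    refine le_of_eq ?_
    simp

theorem memLp_exp_mul_gauss (c : ℝ) :
    MemLp (fun x : ℝ => Real.exp (c * |x|) * Real.exp (-(x ^ 2) / 2)) 2 volume := by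
  refine ((memLp_exp_neg_sq (b := 1 / 4) (by norm_num)).const_mul (Real.exp (c ^ 2))).of_le
    (Continuous.aestronglyMeasurable (by fun_prop)) (Eventually.of_forall fun x => ?_)
  rw [Real.norm_of_nonneg (by positivity), Real.norm_of_nonneg (by positivity), ← Real.exp_add,
    ← Real.exp_add, Real.exp_le_exp]
  nlinarith [sq_nonneg (c - |x| / 2), sq_abs x]

open scoped FourierTransform in
/-- The functions `xⁿ e^{-x²/2}` are complete in `L²(ℝ)`. -/
theorem eq_zero_of_inner_hermiteLp_pow {f : Lp ℂ 2 (volume : Measure ℝ)}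
    (h : ∀ n : ℕ, inner ℂ (hermiteLp (X ^ n)) f = 0) : f = 0 := by
  set g : ℝ → ℂ := fun x => (Real.exp (-(x ^ 2) / 2) : ℂ) * f x with hg
  -- The Gaussian beats every exponential weight. This supplies the dominating function for
  -- integrating the series of $e^{-2\pi ix\xi}$ term by term below, where vanishing moments kill
  -- each term.
  have hgint : ∀ c : ℝ, Integrable fun x => Real.exp (c * |x|) * ‖g x‖ := by
    intro c
    refine ((memLp_exp_mul_gauss c).integrable_mul (Lp.memLp f).norm).congr
      (Eventually.of_forall fun x => ?_)
    simp only [hg, norm_mul, Complex.norm_real, Real.norm_of_nonneg (Real.exp_nonneg _),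
      Pi.mul_apply]
    ring
  have hgm : AEStronglyMeasurable g volume :=
    (Continuous.aestronglyMeasurable (by fun_prop)).mul (Lp.aestronglyMeasurable f)
  have hgi : Integrable g := by
    rw [← integrable_norm_iff hgm]
    simpa using hgint 0
  have hmom : ∀ n : ℕ, ∫ x : ℝ, (x : ℂ) ^ n * g x = 0 := by
    intro n
    rw [← h n, L2.inner_def]
    refine integral_congr_ae ?_
    filter_upwards [hermiteLp_ae (X ^ n)] with x hx
    rw [hx, RCLike.inner_apply, Complex.conj_ofReal, polyGauss, hg]
    simp only [eval_pow, eval_X]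
    push_cast
    ring
  have hF : ∀ ξ, 𝓕 g ξ = 0 := by
    intro ξ
    rw [Real.fourier_real_eq_integral_exp_smul]
    have hsum := hasSum_integral_of_dominated_convergence (μ := (volume : Measure ℝ))
      (F := fun (n : ℕ) (x : ℝ) => (((-2 * Real.pi * x * ξ : ℝ) : ℂ) * Complex.I) ^ n /
        n.factorial * g x)
      (f := fun x : ℝ => Complex.exp (((-2 * Real.pi * x * ξ : ℝ) : ℂ) * Complex.I) • g x)
      (bound := fun n x => |2 * Real.pi * ξ * x| ^ n / n.factorial * ‖g x‖)
      (fun n => (Continuous.aestronglyMeasurable (by fun_prop)).mul hgm)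
      (fun n => Eventually.of_forall fun x => ?_) (Eventually.of_forall fun x => ?_) ?_
      (Eventually.of_forall fun x => ?_)
    · have hz : ∀ n : ℕ, ∫ x : ℝ, (((-2 * Real.pi * x * ξ : ℝ) : ℂ) * Complex.I) ^ n /
          n.factorial * g x = 0 := by
        intro n
        have : ∀ x : ℝ, (((-2 * Real.pi * x * ξ : ℝ) : ℂ) * Complex.I) ^ n / n.factorial * g x =
            ((-2 * Real.pi * ξ * Complex.I) ^ n / n.factorial) * ((x : ℂ) ^ n * g x) := by
          intro x
          push_cast
          ring
        simp only [this]
        rw [integral_const_mul, hmom, mul_zero]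
      simp only [hz] at hsum
      exact hsum.unique hasSum_zero
    · rw [norm_mul, norm_div, norm_pow, norm_mul, Complex.norm_I, mul_one, Complex.norm_real,
        Complex.norm_natCast, Real.norm_eq_abs]
      refine le_of_eq ?_
      rw [← abs_neg]
      ring_nf
    · exact (Real.summable_pow_div_factorial _).mul_right _
    · refine (hgint |2 * Real.pi * ξ|).congr (Eventually.of_forall fun x => ?_)
      simp only
      rw [tsum_mul_right, ← abs_mul, Real.exp_eq_exp_ℝ, NormedSpace.exp_eq_tsum_div]
    · have := NormedSpace.expSeries_div_hasSum_exp (𝔸 := ℂ)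
        (((-2 * Real.pi * x * ξ : ℝ) : ℂ) * Complex.I)
      rw [← Complex.exp_eq_exp_ℂ] at this
      exact this.mul_right _
  rw [Lp.eq_zero_iff_ae_eq_zero]
  filter_upwards [ae_eq_zero_of_fourier_eq_zero hgi hF] with x hx
  rw [hg] at hx
  exact (mul_eq_zero.1 hx).resolve_left (Complex.ofReal_ne_zero.2 (Real.exp_pos _).ne')

end Hermite

/-! ### Hermite functions and their Jacobi matrices -/

section HermiteBasis

open Polynomial

/-- The Hermite polynomials `(-1)ⁿ Hₙ / √(2ⁿ n!)`. -/
noncomputable def hermitePoly : ℕ → ℝ[X]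
  | 0 => 1
  | n + 1 => C (√2 * √(n + 1 : ℝ))⁻¹ * (derivative (hermitePoly n) - 2 * X * hermitePoly n)

theorem hermitePoly_raise (n : ℕ) : derivative (hermitePoly n) - 2 * X * hermitePoly n =
    C (√2 * √(n + 1 : ℝ)) * hermitePoly (n + 1) := by
  have h : √2 * √(n + 1 : ℝ) ≠ 0 := by positivity
  rw [hermitePoly, ← mul_assoc, ← C_mul, mul_inv_cancel₀ h, C_1, one_mul]

theorem derivative_hermitePoly_zero : derivative (hermitePoly 0) = 0 := by
  rw [hermitePoly, derivative_one]

theorem sqrt_two_mul_sqrt_sq (n : ℕ) : (√2 * √(n + 1 : ℝ)) * (√2 * √(n + 1 : ℝ)) = 2 * (n + 1) := by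
  rw [mul_mul_mul_comm, Real.mul_self_sqrt (by norm_num), Real.mul_self_sqrt (by positivity)]

/-- Induction through the commutator of $d/dx$ with $d/dx-2x$, which is $-2$. With the sign in
`hermitePoly`, $(d/dx-x)/\sqrt2$ and $(d/dx+x)/\sqrt2$ act on the Hermite functions exactly as $a$
and $a^+$ act on the $\psi_{-n}$. -/
theorem derivative_hermitePoly_succ (n : ℕ) :
    derivative (hermitePoly (n + 1)) = -(C (√2 * √(n + 1 : ℝ)) * hermitePoly n) := by
  induction n with
  | zero =>
    have h : C (√2 * √((0 : ℕ) + 1 : ℝ)) ≠ 0 := by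
      rw [Ne, C_eq_zero]
      positivity
    apply mul_left_cancel₀ h
    rw [← derivative_C_mul, ← hermitePoly_raise, mul_neg, ← mul_assoc, ← C_mul,
      sqrt_two_mul_sqrt_sq]
    simp [hermitePoly, ← C_ofNat]
  | succ n ih =>
    have h : C (√2 * √((n + 1 : ℕ) + 1 : ℝ)) ≠ 0 := by
      rw [Ne, C_eq_zero]
      positivity
    apply mul_left_cancel₀ h
    rw [← derivative_C_mul, ← hermitePoly_raise, mul_neg, ← mul_assoc, ← C_mul,
      sqrt_two_mul_sqrt_sq]
    have h1 := hermitePoly_raise n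
    have h2 : C (√2 * √(n + 1 : ℝ)) * C (√2 * √(n + 1 : ℝ)) = (2 * (n + 1) : ℝ[X]) := by
      rw [← C_mul, sqrt_two_mul_sqrt_sq]
      simp [← C_ofNat]
    have h3 : C (2 * (((n + 1 : ℕ) : ℝ) + 1)) = (2 * ((n + 1) + 1) : ℝ[X]) := by simp [← C_ofNat]
    have h4 : derivative (2 * X * hermitePoly (n + 1)) =
        2 * hermitePoly (n + 1) + 2 * X * derivative (hermitePoly (n + 1)) := by
      rw [derivative_mul, derivative_mul]
      simp
    rw [derivative_sub, h4, ih, derivative_neg, derivative_C_mul, h3]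
    linear_combination (-C (√2 * √(n + 1 : ℝ))) * h1 - hermitePoly (n + 1) * h2

theorem jacobiVector_map {H H' : Type*} [NormedAddCommGroup H] [InnerProductSpace ℂ H]
    [NormedAddCommGroup H'] [InnerProductSpace ℂ H'] (L : H →ₗ[ℂ] H') (e : ℕ → H) (α : ℂ) (n : ℕ) :
    L (jacobiVector e α n) = jacobiVector (fun n => L (e n)) α n := by
  cases n <;> simp [jacobiVector]

theorem one_div_sqrt_two : 1 / ((√2 : ℝ) : ℂ) = ((√2 : ℝ) : ℂ) / 2 := by
  have h2 : ((√2 : ℝ) : ℂ) ≠ 0 := by simp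
  rw [div_eq_div_iff h2 two_ne_zero, ← Complex.ofReal_mul, Real.mul_self_sqrt (by norm_num)]
  norm_num

theorem one_div_sqrt_two_mul_I :
    1 / (((√2 : ℝ) : ℂ) * Complex.I) = -(((√2 : ℝ) : ℂ) / 2 * Complex.I) := by
  rw [← div_div, one_div_sqrt_two, Complex.div_I]

/-- Multiplication by $x$ is half the lowering minus half the raising operation, $2xp=p'-(p'-2xp)$;
the coefficient is the one occurring in $\tilde Q$. -/
theorem hermiteLp_X_mul_hermitePoly (n : ℕ) : hermiteLp (X * hermitePoly n) =
    jacobiVector (fun n => hermiteLp (hermitePoly n)) (-(1 / ((√2 : ℝ) : ℂ))) n := by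
  have h : X * hermitePoly n = C (1 / 2) * (derivative (hermitePoly n) -
      C (√2 * √(n + 1 : ℝ)) * hermitePoly (n + 1)) := by
    rw [← hermitePoly_raise, sub_sub_cancel, ← mul_assoc, ← mul_assoc,
      show (2 : ℝ[X]) = C 2 from rfl, ← C_mul]
    norm_num
  rw [one_div_sqrt_two, h, hermiteLp_C_mul, hermiteLp_sub, hermiteLp_C_mul]
  cases n with
  | zero =>
    rw [derivative_hermitePoly_zero, hermiteLp_zero, jacobiVector, zero_sub, ← neg_smul, smul_smul]
    congr 1
    push_cast
    rw [zero_add, Real.sqrt_one, Complex.ofReal_one]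
    ring
  | succ n =>
    rw [derivative_hermitePoly_succ, ← neg_mul, ← C_neg, hermiteLp_C_mul, jacobiVector, smul_sub,
      smul_smul, smul_smul, sub_eq_neg_add, ← neg_smul]
    have e : ((n + 1 : ℕ) + 1 : ℝ) = n + 2 := by push_cast; ring
    rw [e]
    congr 2
    · push_cast
      ring
    · simp only [map_neg, map_div₀, Complex.conj_ofReal, map_ofNat]
      push_cast
      ring

/-- Differentiation is half the sum of lowering and raising, $2(p'-xp)=p'+(p'-2xp)$; the coefficient
is the one occurring in $\tilde P$. -/
theorem hermiteLp_derivative_hermitePoly (n : ℕ) :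
    hermiteLp (derivative (hermitePoly n) - X * hermitePoly n) =
    Complex.I • jacobiVector (fun n => hermiteLp (hermitePoly n))
      (1 / (((√2 : ℝ) : ℂ) * Complex.I)) n := by
  have h : derivative (hermitePoly n) - X * hermitePoly n = C (1 / 2) * (derivative (hermitePoly n) +
      C (√2 * √(n + 1 : ℝ)) * hermitePoly (n + 1)) := by
    have h' : C (1 / 2 : ℝ) * 2 = 1 := by
      rw [show (2 : ℝ[X]) = C 2 from rfl, ← C_mul]
      norm_num
    rw [← hermitePoly_raise]
    linear_combination (X * hermitePoly n - derivative (hermitePoly n)) * h'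
  rw [one_div_sqrt_two_mul_I, h, hermiteLp_C_mul, hermiteLp_add, hermiteLp_C_mul]
  cases n with
  | zero =>
    rw [derivative_hermitePoly_zero, hermiteLp_zero, jacobiVector, zero_add, smul_smul, smul_smul]
    congr 1
    push_cast
    rw [zero_add, Real.sqrt_one, Complex.ofReal_one]
    linear_combination ((√2 : ℝ) : ℂ) / 2 * Complex.I_sq
  | succ n =>
    rw [derivative_hermitePoly_succ, ← neg_mul, ← C_neg, hermiteLp_C_mul, jacobiVector, smul_add,
      smul_add, smul_smul, smul_smul, smul_smul, smul_smul, add_comm]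
    have e : ((n + 1 : ℕ) + 1 : ℝ) = n + 2 := by push_cast; ring
    rw [e]
    congr 2
    · push_cast
      linear_combination ((√2 : ℝ) : ℂ) / 2 * (√(n + 2 : ℝ) : ℝ) * Complex.I_sq
    · simp only [map_mul, map_neg, map_div₀, Complex.conj_ofReal, Complex.conj_I, map_ofNat]
      push_cast
      linear_combination -((√2 : ℝ) : ℂ) / 2 * (√(n + 1 : ℝ) : ℝ) * Complex.I_sq

theorem hermiteLp_one_ne_zero : hermiteLp 1 ≠ 0 := by
  intro h0
  have h := hermiteLp_ae 1
  rw [h0] at h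
  have h1 : ∀ᵐ x : ℝ, False := by
    filter_upwards [h, Lp.coeFn_zero ℂ 2 (volume : Measure ℝ)] with x h1 h2
    rw [h2, polyGauss, eval_one, one_mul] at h1
    exact (Real.exp_pos _).ne' (Complex.ofReal_eq_zero.1 h1.symm)
  exact NeZero.ne (volume : Measure ℝ) (by simpa using h1)

theorem orthonormal_hermiteLp : Orthonormal ℂ fun n =>
    ((‖hermiteLp (hermitePoly 0)‖⁻¹ : ℝ) : ℂ) • hermiteLp (hermitePoly n) := by
  have h2 : ((√2 : ℝ) : ℂ) ≠ 0 := by simp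
  have hs : ∀ n : ℕ, ((√(n + 1 : ℝ) : ℝ) : ℂ) ≠ 0 := fun n => by
    rw [Complex.ofReal_ne_zero]
    positivity
  have key : ∀ (n : ℕ) (q : ℝ[X]), ((√2 : ℝ) : ℂ) * (√(n + 1 : ℝ) : ℝ) *
      inner ℂ (hermiteLp (hermitePoly (n + 1))) (hermiteLp q) =
      -inner ℂ (hermiteLp (hermitePoly n)) (hermiteLp (derivative q)) := by
    intro n q
    rw [← inner_hermiteLp_raise, hermitePoly_raise, hermiteLp_C_mul, inner_smul_left,
      Complex.conj_ofReal, Complex.ofReal_mul]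
  refine orthonormal_of_ladder (v := fun n => hermiteLp (hermitePoly n)) hermiteLp_one_ne_zero
    (fun n => ?_) fun n m => ?_
  · have := key n (hermitePoly 0)
    rw [derivative_hermitePoly_zero, hermiteLp_zero, inner_zero_right, neg_zero] at this
    exact (mul_eq_zero.1 this).resolve_left (mul_ne_zero h2 (hs n))
  · apply mul_left_cancel₀ h2
    have := key n (hermitePoly (m + 1))
    rw [derivative_hermitePoly_succ, ← neg_mul, ← C_neg, hermiteLp_C_mul, inner_smul_right] at this
    push_cast at this
    linear_combination this

/-- A factor $x$ can be traded for neighbouring Hermite indices, hence induction on `k` for all `n`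
at once. At `n = 0` this reaches the pure monomials needed for completeness. -/
theorem inner_hermiteLp_eq_zero {f : Lp ℂ 2 (volume : Measure ℝ)}
    (hf : ∀ n, inner ℂ (hermiteLp (hermitePoly n)) f = 0) (k n : ℕ) :
    inner ℂ (hermiteLp (X ^ k * hermitePoly n)) f = 0 := by
  induction k generalizing n with
  | zero => rw [pow_zero, one_mul, hf]
  | succ k ih =>
    have h : X ^ (k + 1) * hermitePoly n = C (1 / 2) * (X ^ k * derivative (hermitePoly n) -
        C (√2 * √(n + 1 : ℝ)) * (X ^ k * hermitePoly (n + 1))) := by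
      have h' : C (1 / 2 : ℝ) * 2 = 1 := by
        rw [show (2 : ℝ[X]) = C 2 from rfl, ← C_mul]
        norm_num
      linear_combination (-X ^ (k + 1) * hermitePoly n) * h' -
        C (1 / 2) * X ^ k * hermitePoly_raise n
    have hd : inner ℂ (hermiteLp (X ^ k * derivative (hermitePoly n))) f = 0 := by
      cases n with
      | zero => rw [derivative_hermitePoly_zero, mul_zero, hermiteLp_zero, inner_zero_left]
      | succ n =>
        rw [derivative_hermitePoly_succ, ← neg_mul, ← C_neg, mul_left_comm, hermiteLp_C_mul,
          inner_smul_left, ih, mul_zero]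
    rw [h, hermiteLp_C_mul, hermiteLp_sub, hermiteLp_C_mul, inner_smul_left, inner_sub_left,
      inner_smul_left, ih, hd, mul_zero, sub_zero, mul_zero]

/-- The Hermite functions as a Hilbert basis of `L²(ℝ)`. -/
noncomputable def hermiteBasis : HilbertBasis ℕ ℂ (Lp ℂ 2 (volume : Measure ℝ)) :=
  HilbertBasis.mkOfOrthogonalEqBot orthonormal_hermiteLp <| by
    rw [Submodule.eq_bot_iff]
    intro f hf
    have hne : ((‖hermiteLp (hermitePoly 0)‖⁻¹ : ℝ) : ℂ) ≠ 0 :=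
      Complex.ofReal_ne_zero.2 (inv_ne_zero (norm_ne_zero_iff.2 hermiteLp_one_ne_zero))
    have h : ∀ n, inner ℂ (hermiteLp (hermitePoly n)) f = 0 := by
      intro n
      have := (Submodule.mem_orthogonal _ _).1 hf _ (Submodule.subset_span ⟨n, rfl⟩)
      rw [inner_smul_left, Complex.conj_ofReal] at this
      exact (mul_eq_zero.1 this).resolve_left hne
    refine eq_zero_of_inner_hermiteLp_pow fun k => ?_
    simpa [hermitePoly] using inner_hermiteLp_eq_zero h k 0

theorem hermiteBasis_apply (n : ℕ) : hermiteBasis n =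
    ((‖hermiteLp (hermitePoly 0)‖⁻¹ : ℝ) : ℂ) • hermiteLp (hermitePoly n) := by
  rw [hermiteBasis, HilbertBasis.coe_mkOfOrthogonalEqBot]

theorem jacobiVector_hermiteBasis (α : ℂ) (n : ℕ) : jacobiVector hermiteBasis α n =
    ((‖hermiteLp (hermitePoly 0)‖⁻¹ : ℝ) : ℂ) •
      jacobiVector (fun n => hermiteLp (hermitePoly n)) α n := by
  have := jacobiVector_map (LinearMap.lsmul ℂ (Lp ℂ 2 (volume : Measure ℝ))
    ((‖hermiteLp (hermitePoly 0)‖⁻¹ : ℝ) : ℂ)) (fun n => hermiteLp (hermitePoly n)) α n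
  rw [LinearMap.lsmul_apply] at this
  rw [this]
  congr 1
  funext n
  exact hermiteBasis_apply n

theorem hasDerivAt_translation_hermiteBasis (n : ℕ) :
    HasDerivAt (fun t => translation t (hermiteBasis n)) (Complex.I • jacobiVector hermiteBasis
      (1 / (((√2 : ℝ) : ℂ) * Complex.I)) n) 0 := by
  rw [jacobiVector_hermiteBasis, smul_comm, ← hermiteLp_derivative_hermitePoly]
  simp only [hermiteBasis_apply, map_smul]
  exact HasDerivAt.const_smul (R := ℂ) _ (hasDerivAt_translation_hermiteLp _)

theorem hasDerivAt_modulation_hermiteBasis (n : ℕ) :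
    HasDerivAt (fun s => modulation s (hermiteBasis n)) (Complex.I • jacobiVector hermiteBasis
      (-(1 / ((√2 : ℝ) : ℂ))) n) 0 := by
  rw [jacobiVector_hermiteBasis, smul_comm, ← hermiteLp_X_mul_hermitePoly]
  simp only [hermiteBasis_apply, map_smul]
  exact HasDerivAt.const_smul (R := ℂ) _ (hasDerivAt_modulation_hermiteLp _)

end HermiteBasis

/-! ### Transport of the Schrödinger groups along a basis -/

section SchrodingerTransport

variable {H : Type u} [NormedAddCommGroup H] [InnerProductSpace ℂ H]

/-- The unitary taking a Hilbert basis to the Hermite functions. -/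
noncomputable def HilbertBasis.toHermite (e : HilbertBasis ℕ ℂ H) :
    H ≃ₗᵢ[ℂ] Lp ℂ 2 (volume : Measure ℝ) :=
  e.repr.trans hermiteBasis.repr.symm

theorem HilbertBasis.toHermite_apply (e : HilbertBasis ℕ ℂ H) (n : ℕ) :
    e.toHermite (e n) = hermiteBasis n := by
  rw [HilbertBasis.toHermite, LinearIsometryEquiv.trans_apply, e.repr_self,
    HilbertBasis.repr_symm_single]

theorem HilbertBasis.toHermite_symm_jacobiVector (e : HilbertBasis ℕ ℂ H) (α : ℂ) (n : ℕ) :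
    e.toHermite.symm (jacobiVector hermiteBasis α n) = jacobiVector e α n := by
  have := jacobiVector_map (e.toHermite.symm.toLinearEquiv : _ →ₗ[ℂ] H) hermiteBasis α n
  refine this.trans ?_
  congr 1
  funext n
  exact (LinearIsometryEquiv.symm_apply_eq _).2 (e.toHermite_apply n).symm

/-- Transport of a family of unitary operators of `L²(ℝ)`. -/
noncomputable def HilbertBasis.transport (e : HilbertBasis ℕ ℂ H)
    (τ : ℝ → Lp ℂ 2 (volume : Measure ℝ) ≃ₗᵢ[ℂ] Lp ℂ 2 (volume : Measure ℝ)) (t : ℝ) :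
    H ≃ₗᵢ[ℂ] H :=
  (e.toHermite.trans (τ t)).trans e.toHermite.symm

theorem HilbertBasis.transport_apply (e : HilbertBasis ℕ ℂ H)
    (τ : ℝ → Lp ℂ 2 (volume : Measure ℝ) ≃ₗᵢ[ℂ] Lp ℂ 2 (volume : Measure ℝ)) (t : ℝ) (x : H) :
    e.transport τ t x = e.toHermite.symm (τ t (e.toHermite x)) := rfl

theorem HilbertBasis.toHermite_transport (e : HilbertBasis ℕ ℂ H)
    (τ : ℝ → Lp ℂ 2 (volume : Measure ℝ) ≃ₗᵢ[ℂ] Lp ℂ 2 (volume : Measure ℝ)) (t : ℝ) (x : H) :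
    e.toHermite (e.transport τ t x) = τ t (e.toHermite x) :=
  e.toHermite.apply_symm_apply _

/-- Only the matrix on the basis matters: equal Jacobi vectors on the two sides make the transported
group have the right derivative on a core. -/
theorem isExpI_transport [CompleteSpace H] (e : HilbertBasis ℕ ℂ H) {T : H →ₗ.[ℂ] H}
    (hT : IsEssentiallySelfAdjoint T) {α : ℂ} (hcore : T.closure.graph =
      (Submodule.span ℂ (Set.range fun n => (e n, jacobiVector e α n))).topologicalClosure)
    {τ : ℝ → Lp ℂ 2 (volume : Measure ℝ) ≃ₗᵢ[ℂ] Lp ℂ 2 (volume : Measure ℝ)}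
    (hadd : ∀ s t f, τ (s + t) f = τ s (τ t f))
    (hd : ∀ n, HasDerivAt (fun t => τ t (hermiteBasis n))
      (Complex.I • jacobiVector hermiteBasis α n) 0) :
    IsExpI T.closure (e.transport τ) := by
  refine isExpI_of_core hT (fun s t x => ?_) ?_ hcore fun n => ?_
  · rw [e.transport_apply, e.transport_apply, e.toHermite_transport, hadd]
  · rw [Submodule.dense_iff_topologicalClosure_eq_top, e.dense_span]
  · simp only [e.transport_apply, e.toHermite_apply]
    rw [← e.toHermite_symm_jacobiVector, ← map_smul]
    exact ((e.toHermite.symm.toContinuousLinearEquiv.toContinuousLinearMap.restrictScalars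
      ℝ).hasFDerivAt.comp_hasDerivAt 0 (hd n))

theorem weylRelations_transport (e : HilbertBasis ℕ ℂ H) :
    WeylRelations (e.transport translation) (e.transport modulation) := by
  intro t s x
  rw [e.transport_apply translation, e.toHermite_transport, translation_modulation, map_smul,
    e.transport_apply modulation, e.toHermite_transport]

theorem isDirectSumOfSchrodinger_transport (e : HilbertBasis ℕ ℂ H) :
    IsDirectSumOfSchrodinger (e.transport translation) (e.transport modulation) := by
  -- One summand suffices, since the single ladder already spans a dense subspace.
  refine ⟨PUnit, e.toHermite.trans (lpPUnit _), fun x i => ⟨fun t => ?_, fun s => ?_⟩⟩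
  · exact (Lp.ext_iff.1 (e.toHermite_transport translation t x)).trans (translation_ae t _)
  · exact (Lp.ext_iff.1 (e.toHermite_transport modulation s x)).trans (modulation_ae s _)

end SchrodingerTransport

/-! ### Operator sums, multiples and commutators in terms of graphs -/

section LinearPMapGraph

variable {H : Type u} [NormedAddCommGroup H] [InnerProductSpace ℂ H]

theorem LinearPMap.exists_apply_eq {T : H →ₗ.[ℂ] H} {x y : H} (h : (x, y) ∈ T.graph) :
    ∃ hx : x ∈ T.domain, T ⟨x, hx⟩ = y := by
  obtain ⟨z, rfl, hz⟩ := (LinearPMap.mem_graph_iff _).1 h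
  exact ⟨z.2, hz⟩

theorem LinearPMap.mem_graph_neg {T : H →ₗ.[ℂ] H} {x y : H} :
    (x, y) ∈ (-T).graph ↔ (x, -y) ∈ T.graph := by
  rw [LinearPMap.mem_graph_iff, LinearPMap.mem_graph_iff]
  constructor
  · rintro ⟨z, rfl, hz⟩
    refine ⟨z, rfl, ?_⟩
    simp only at hz
    rw [← hz, LinearPMap.neg_apply, neg_neg]
  · rintro ⟨z, rfl, hz⟩
    refine ⟨z, rfl, ?_⟩
    simp only at hz
    rw [LinearPMap.neg_apply, hz, neg_neg]

theorem LinearPMap.mem_graph_add {A B : H →ₗ.[ℂ] H} {x y : H} :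
    (x, y) ∈ (A + B).graph ↔ ∃ u v, (x, u) ∈ A.graph ∧ (x, v) ∈ B.graph ∧ y = u + v := by
  constructor
  · intro h
    obtain ⟨⟨z, hA, hB⟩, rfl, hz⟩ := (LinearPMap.mem_graph_iff _).1 h
    exact ⟨A ⟨z, hA⟩, B ⟨z, hB⟩, A.mem_graph ⟨z, hA⟩, B.mem_graph ⟨z, hB⟩, hz.symm⟩
  · rintro ⟨u, v, hu, hv, rfl⟩
    obtain ⟨⟨z, hA⟩, hz, hAz⟩ := (LinearPMap.mem_graph_iff _).1 hu
    obtain ⟨⟨z', hB⟩, hz', hBz⟩ := (LinearPMap.mem_graph_iff _).1 hv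
    simp only at hz hz' hAz hBz
    subst hz hz' hAz hBz
    exact (A + B).mem_graph ⟨z', hA, hB⟩

theorem LinearPMap.mem_graph_smul {A : H →ₗ.[ℂ] H} {k : ℂ} {x y : H} :
    (x, y) ∈ (k • A).graph ↔ ∃ u, (x, u) ∈ A.graph ∧ y = k • u := by
  constructor
  · intro h
    obtain ⟨⟨z, hA⟩, rfl, hz⟩ := (LinearPMap.mem_graph_iff _).1 h
    exact ⟨A ⟨z, hA⟩, A.mem_graph ⟨z, hA⟩, hz.symm⟩
  · rintro ⟨u, hu, rfl⟩
    obtain ⟨z, rfl, hz⟩ := (LinearPMap.mem_graph_iff _).1 hu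
    simp only at hz
    subst hz
    exact (k • A).mem_graph z

theorem commutatorEqOn_iff {A B : H →ₗ.[ℂ] H} {c : ℂ} {D : Submodule ℂ H} :
    CommutatorEqOn A B c D ↔ ∀ x ∈ D, ∃ u v w w', (x, u) ∈ A.graph ∧ (x, v) ∈ B.graph ∧
      (v, w) ∈ A.graph ∧ (u, w') ∈ B.graph ∧ w - w' = c • x := by
  refine forall₂_congr fun x _ => ⟨?_, ?_⟩
  · rintro ⟨hA, hB, hAB, hBA, h⟩
    exact ⟨_, _, _, _, A.mem_graph ⟨x, hA⟩, B.mem_graph ⟨x, hB⟩, A.mem_graph ⟨_, hAB⟩,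
      B.mem_graph ⟨_, hBA⟩, h⟩
  · rintro ⟨u, v, w, w', hu, hv, hw, hw', h⟩
    obtain ⟨hA, rfl⟩ := LinearPMap.exists_apply_eq hu
    obtain ⟨hB, rfl⟩ := LinearPMap.exists_apply_eq hv
    obtain ⟨hAB, rfl⟩ := LinearPMap.exists_apply_eq hw
    obtain ⟨hBA, rfl⟩ := LinearPMap.exists_apply_eq hw'
    exact ⟨hA, hB, hAB, hBA, h⟩

/-- The commutation relation solved for $BAx$, given $ABx$. -/
theorem CommutatorEqOn.graph {A B : H →ₗ.[ℂ] H} {c : ℂ} {D : Submodule ℂ H}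
    (h : CommutatorEqOn A B c D) {x u v w : H} (hx : x ∈ D) (hu : (x, u) ∈ A.graph)
    (hv : (x, v) ∈ B.graph) (hw : (v, w) ∈ A.graph) : (u, w - c • x) ∈ B.graph := by
  obtain ⟨u', v', w', z, hu', hv', hw', hz, e⟩ := commutatorEqOn_iff.1 h x hx
  obtain rfl := A.mem_graph_snd_inj hu hu' rfl
  obtain rfl := B.mem_graph_snd_inj hv hv' rfl
  obtain rfl := A.mem_graph_snd_inj hw hw' rfl
  rwa [← e, sub_sub_cancel]

theorem HilbertBasis.dense_of_mem (e : HilbertBasis ℕ ℂ H) {p : Submodule ℂ H}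
    (h : ∀ n, e n ∈ p) : Dense (p : Set H) := by
  have h1 : Dense (Submodule.span ℂ (Set.range e) : Set H) := by
    rw [Submodule.dense_iff_topologicalClosure_eq_top, e.dense_span]
  exact h1.mono (Submodule.span_le.2 (Set.range_subset_iff.2 h))

theorem IsStableUnder.exists_graph {D : Submodule ℂ H} {A : H →ₗ.[ℂ] H} (h : IsStableUnder D A)
    {x : H} (hx : x ∈ D) : ∃ y ∈ D, (x, y) ∈ A.graph := by
  obtain ⟨hA, hy⟩ := h x hx
  exact ⟨_, hy, A.mem_graph ⟨x, hA⟩⟩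

end LinearPMapGraph

/-! ### Essential self-adjointness of combinations of ladder operators -/

section LadderOperators

variable {H : Type u} [NormedAddCommGroup H] [InnerProductSpace ℂ H] [CompleteSpace H]

/-- The sign `s` treats $\tilde P$ ($s=1$, `k` imaginary) and $\tilde Q$ ($s=-1$, `k` real)
together. The condition `hk` together with `hab` gives symmetry on the whole common domain, and it
makes the matrix a Jacobi matrix with parameter `k * s`. -/
theorem ladder_essentiallySelfAdjoint (e : HilbertBasis ℕ ℂ H) {a b T : H →ₗ.[ℂ] H}
    (ha : ∀ n : ℕ, (e n, ((√(n + 1 : ℝ) : ℝ) : ℂ) • e (n + 1)) ∈ a.graph)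
    (hb0 : (e 0, 0) ∈ b.graph)
    (hb : ∀ n : ℕ, (e (n + 1), -((√(n + 1 : ℝ) : ℝ) : ℂ) • e n) ∈ b.graph)
    (hab : ∀ {x u y v}, (x, u) ∈ a.graph → (y, v) ∈ b.graph → inner ℂ v x = -inner ℂ y u)
    {k s : ℂ} (hs : s = 1 ∨ s = -1) (hk0 : k ≠ 0) (hk : starRingEnd ℂ k = -(s * k))
    (hT : ∀ {x w}, (x, w) ∈ T.graph ↔
      ∃ u v, (x, u) ∈ a.graph ∧ (x, v) ∈ b.graph ∧ w = k • (v + s • u)) :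
    IsEssentiallySelfAdjoint T ∧ T.closure.graph =
      (Submodule.span ℂ (Set.range fun n => (e n, jacobiVector e (k * s) n))).topologicalClosure := by
  have hss : s * s = 1 := by rcases hs with rfl | rfl <;> norm_num
  have hs0 : s ≠ 0 := by rcases hs with rfl | rfl <;> norm_num
  have hcs : starRingEnd ℂ s = s := by rcases hs with rfl | rfl <;> simp
  have hv : ∀ n, (e n, jacobiVector e (k * s) n) ∈ T.graph := by
    rintro (_ | n)
    · refine hT.2 ⟨_, _, ha 0, hb0, ?_⟩
      simp [jacobiVector, smul_smul]
    · refine hT.2 ⟨_, _, ha (n + 1), hb n, ?_⟩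
      have e1 : ((n + 1 : ℕ) + 1 : ℝ) = n + 2 := by push_cast; ring
      rw [jacobiVector, e1, map_mul, hcs, hk, smul_add, smul_smul, smul_smul, smul_smul, add_comm]
      congr 2
      · linear_combination (-k * ((√(n + 1 : ℝ) : ℝ) : ℂ)) * hss
  refine essentiallySelfAdjoint_of_deficiency ?_ ?_ hv fun s' hs' y hy =>
    jacobi_deficiency e (mul_ne_zero hk0 hs0) hs' y hy
  · exact e.dense_of_mem fun n => LinearPMap.mem_domain_of_mem_graph (hv n)
  · rintro ⟨x, w⟩ hp ⟨x', w'⟩ hq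
    obtain ⟨u, v, hu, hv, rfl⟩ := hT.1 hp
    obtain ⟨u', v', hu', hv', rfl⟩ := hT.1 hq
    have h1 : inner ℂ v x' = -inner ℂ x u' := hab hu' hv
    have h2 : inner ℂ u x' = -inner ℂ x v' := by
      rw [← inner_conj_symm, ← inner_conj_symm x v', hab hu hv', map_neg, neg_neg]
    simp only [inner_smul_left, inner_smul_right, inner_add_left, inner_add_right, h1, h2, hk, hcs]
    linear_combination k * inner ℂ x v' * hss

end LadderOperators

/-! ### The indefinite adjoint in terms of the Hilbert space adjoint -/

namespace KreinSpace

variable {K : Type u} [AddCommGroup K] [Module ℂ K] (S : KreinSpace K)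

theorem inner_symm_eq_of_mem_graph {A : S.JSpace →ₗ.[ℂ] S.JSpace}
    (hA : Dense (A.domain : Set S.JSpace)) {x u y z : S.JSpace} (hu : (x, u) ∈ A.graph)
    (hz : (y, z) ∈ (S.kreinAdjoint A).graph) :
    inner ℂ u (S.symm y) = inner ℂ x (S.symm z) := by
  obtain ⟨hx, rfl⟩ := LinearPMap.exists_apply_eq hu
  have := (S.mem_graph_kreinAdjoint_iff hA y z).1 hz ⟨x, hx⟩
  rwa [bracket_eq, bracket_eq] at this

theorem mem_graph_kreinAdjoint {A : S.JSpace →ₗ.[ℂ] S.JSpace}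
    (hA : Dense (A.domain : Set S.JSpace)) {y z : S.JSpace} :
    (y, z) ∈ (S.kreinAdjoint A).graph ↔ (S.symm y, S.symm z) ∈ A.adjoint.graph := by
  refine ⟨fun h => (LinearPMap.mem_graph_adjoint hA).2 fun p hp =>
    S.inner_symm_eq_of_mem_graph hA hp h, fun h => ?_⟩
  rw [S.mem_graph_kreinAdjoint_iff hA]
  intro x
  rw [bracket_eq, bracket_eq]
  exact (LinearPMap.mem_graph_adjoint hA).1 h _ (A.mem_graph x)

end KreinSpace

/-! ### The orthonormal basis of an anti-Fock representation -/

namespace IsAntiFock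

variable {K : Type u} [AddCommGroup K] [Module ℂ K] {S : KreinSpace K}
  {a : S.JSpace →ₗ.[ℂ] S.JSpace} {D : Submodule ℂ S.JSpace} {ψ : ℕ → S.JSpace}

theorem dense_domain (h : IsAntiFock S a D ψ) : Dense (a.domain : Set S.JSpace) :=
  h.dense.mono fun x hx => (h.stable x hx).1

theorem dense_adjoint_domain (h : IsAntiFock S a D ψ) :
    Dense ((S.kreinAdjoint a).domain : Set S.JSpace) :=
  h.dense.mono fun x hx => (h.stable_adjoint x hx).1

theorem sqrt_ne_zero (n : ℕ) : ((√(n + 1 : ℝ) : ℝ) : ℂ) ≠ 0 := by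
  rw [Complex.ofReal_ne_zero]
  positivity

theorem sqrt_mul_self (n : ℕ) :
    ((√(n + 1 : ℝ) : ℝ) : ℂ) * ((√(n + 1 : ℝ) : ℝ) : ℂ) = n + 1 := by
  rw [← Complex.ofReal_mul, Real.mul_self_sqrt (by positivity)]
  push_cast
  ring

/-- By the CCR, $a^+a\psi=aa^+\psi-\psi$; starting from $a^+\psi_{-1}=0$, induction turns this into
the eigenvalue $-(n+1)$ on `ψ n`, and dividing by $\sqrt{n+1}$ gives the claim. -/
theorem lower (h : IsAntiFock S a D ψ) (n : ℕ) :
    (ψ (n + 1), -((√(n + 1 : ℝ) : ℝ) : ℂ) • ψ n) ∈ (S.kreinAdjoint a).graph := by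
  have key : ∀ {n : ℕ}, (((√(n + 1 : ℝ) : ℝ) : ℂ) • ψ (n + 1), -((n : ℂ) + 1) • ψ n) ∈
      (S.kreinAdjoint a).graph →
      (ψ (n + 1), -((√(n + 1 : ℝ) : ℝ) : ℂ) • ψ n) ∈ (S.kreinAdjoint a).graph := by
    intro n hn
    have := (S.kreinAdjoint a).graph.smul_mem (((√(n + 1 : ℝ) : ℝ) : ℂ)⁻¹) hn
    rw [← sqrt_mul_self, Prod.smul_mk, smul_smul, smul_smul, inv_mul_cancel₀ (sqrt_ne_zero n),
      one_smul, mul_neg, inv_mul_cancel_left₀ (sqrt_ne_zero n)] at this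
    exact this
  induction n with
  | zero =>
    apply key
    have := h.ccr.graph (h.mem 0) (h.raise 0) h.antiFock a.graph.zero_mem
    simpa using this
  | succ n ih =>
    apply key
    have h1 := a.graph.smul_mem (-((√(n + 1 : ℝ) : ℝ) : ℂ)) (h.raise n)
    have := h.ccr.graph (h.mem (n + 1)) (h.raise (n + 1)) ih h1
    rw [smul_smul, neg_mul, sqrt_mul_self, ← sub_smul] at this
    convert this using 3
    push_cast
    ring

/-- Adjointness between neighbouring levels gives
$\sigma_{n+1}\|\psi_{n+1}\|^2=-\sigma_n\|\psi_n\|^2$. So no vector vanishes, and positivity of the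
norms makes the signs alternate. -/
theorem exists_sign (h : IsAntiFock S a D ψ) : ∃ σ : ℕ → ℂ,
    (∀ n, σ n * σ n = 1) ∧ (∀ n, starRingEnd ℂ (σ n) = σ n) ∧ (∀ n, σ (n + 1) = -σ n) ∧
      ∀ n, S.symm (ψ n) = σ n • ψ n := by
  have h1 : ∀ n, ∃ σ : ℝ, (σ = 1 ∨ σ = -1) ∧ S.symm (ψ n) = (σ : ℂ) • ψ n := by
    intro n
    rcases h.adapted n with hp | hn
    · refine ⟨1, Or.inl rfl, ?_⟩
      rw [Complex.ofReal_one, one_smul]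
      exact S.J_of_mem_pos hp
    · refine ⟨-1, Or.inr rfl, ?_⟩
      rw [Complex.ofReal_neg, Complex.ofReal_one, neg_one_smul]
      exact S.J_of_mem_neg hn
  choose σ hσ hψ using h1
  have h2 : ∀ n, σ (n + 1) * ‖ψ (n + 1)‖ ^ 2 = -(σ n * ‖ψ n‖ ^ 2) := by
    intro n
    have := S.inner_symm_eq_of_mem_graph h.dense_domain (h.raise n) (h.lower n)
    rw [map_smul, hψ, hψ, inner_smul_left, inner_smul_right, inner_smul_right, inner_smul_right,
      Complex.conj_ofReal, inner_self_eq_norm_sq_to_K, inner_self_eq_norm_sq_to_K, neg_mul,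
      ← mul_neg] at this
    have := mul_left_cancel₀ (sqrt_ne_zero n) this
    apply Complex.ofReal_injective
    push_cast
    exact this
  have h3 : ∀ n, ψ n ≠ 0 := by
    intro n
    induction n with
    | zero => exact h.ne_zero
    | succ n ih =>
      intro h0
      have := h2 n
      rw [h0, norm_zero] at this
      have h4 : 0 < ‖ψ n‖ ^ 2 := pow_pos (norm_pos_iff.2 ih) 2
      rcases hσ n with h5 | h5 <;> rw [h5] at this <;> nlinarith
  refine ⟨fun n => σ n, fun n => ?_, fun n => Complex.conj_ofReal _, fun n => ?_, hψ⟩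
  · rcases hσ n with h5 | h5 <;> simp [h5]
  · have h4 : 0 < ‖ψ n‖ ^ 2 := pow_pos (norm_pos_iff.2 (h3 n)) 2
    have h4' : 0 < ‖ψ (n + 1)‖ ^ 2 := pow_pos (norm_pos_iff.2 (h3 (n + 1))) 2
    have := h2 n
    show ((σ (n + 1) : ℝ) : ℂ) = -((σ n : ℝ) : ℂ)
    rcases hσ n with h5 | h5 <;> rcases hσ (n + 1) with h6 | h6 <;> rw [h5, h6] at this ⊢
    · nlinarith
    · simp
    · simp
    · nlinarith

theorem exists_basis (h : IsAntiFock S a D ψ) :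
    ∃ (e : HilbertBasis ℕ ℂ S.JSpace) (c : ℂ), ∀ n, e n = c • ψ n := by
  obtain ⟨σ, hσ, hσc, hσs, hψ⟩ := h.exists_sign
  have key : ∀ n m : ℕ, ((√(n + 1 : ℝ) : ℝ) : ℂ) * inner ℂ (ψ (n + 1)) (S.symm (ψ m)) =
      inner ℂ (((√(n + 1 : ℝ) : ℝ) : ℂ) • ψ (n + 1)) (S.symm (ψ m)) := fun n m => by
    rw [inner_smul_left, Complex.conj_ofReal]
  have hσ0 : ∀ n, σ n ≠ 0 := fun n h0 => by simpa [h0] using hσ n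
  have horth := orthonormal_of_ladder h.ne_zero (fun n => ?_) fun n m => ?_
  · refine ⟨HilbertBasis.mk horth ?_, _, fun n => by rw [HilbertBasis.coe_mk]⟩
    have hne : ((‖ψ 0‖⁻¹ : ℝ) : ℂ) ≠ 0 :=
      Complex.ofReal_ne_zero.2 (inv_ne_zero (norm_ne_zero_iff.2 h.ne_zero))
    rw [← Submodule.dense_iff_topologicalClosure_eq_top.1 h.complete]
    refine Submodule.topologicalClosure_mono (Submodule.span_le.2 ?_)
    rintro _ ⟨n, rfl⟩
    have := (Submodule.span ℂ (Set.range fun n => ((‖ψ 0‖⁻¹ : ℝ) : ℂ) • ψ n)).smul_mem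
      (((‖ψ 0‖⁻¹ : ℝ) : ℂ)⁻¹) (Submodule.subset_span ⟨n, rfl⟩)
    rwa [smul_smul, inv_mul_cancel₀ hne, one_smul] at this
  · have h1 := key n 0
    rw [S.inner_symm_eq_of_mem_graph h.dense_domain (h.raise n) h.antiFock, map_zero,
      inner_zero_right, hψ, inner_smul_right] at h1
    exact (mul_eq_zero.1 ((mul_eq_zero.1 h1).resolve_left (sqrt_ne_zero n))).resolve_left (hσ0 0)
  -- The minus sign of the lowering relation cancels against the alternation of `σ`, leaving the
  -- ladder relation of an ordinary Fock space.
  · have h1 := key n (m + 1)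
    rw [S.inner_symm_eq_of_mem_graph h.dense_domain (h.raise n) (h.lower m), map_smul, hψ, hψ,
      inner_smul_right, inner_smul_right, inner_smul_right, hσs] at h1
    apply mul_left_cancel₀ (hσ0 m)
    linear_combination -h1

end IsAntiFock

/-! ### The commutator of momentum and position -/

section Commutators

variable {H : Type u} [NormedAddCommGroup H] [InnerProductSpace ℂ H]

/-- Formally $[b+a,b-a]=2[a,b]$; stability of `D` ensures that all the products are defined. -/
theorem commutatorEqOn_momentum_position {a b P Q : H →ₗ.[ℂ] H} {D : Submodule ℂ H}
    (ha : IsStableUnder D a) (hb : IsStableUnder D b) (hab : CommutatorEqOn a b 1 D) {k l : ℂ}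
    (hP : ∀ {x w}, (x, w) ∈ P.graph ↔ ∃ u v, (x, u) ∈ a.graph ∧ (x, v) ∈ b.graph ∧
      w = k • (v + (1 : ℂ) • u))
    (hQ : ∀ {x w}, (x, w) ∈ Q.graph ↔ ∃ u v, (x, u) ∈ a.graph ∧ (x, v) ∈ b.graph ∧
      w = l • (v + (-1 : ℂ) • u)) : CommutatorEqOn P Q (2 * (k * l)) D := by
  refine commutatorEqOn_iff.2 fun x hx => ?_
  obtain ⟨u, huD, hu⟩ := ha.exists_graph hx
  obtain ⟨v, hvD, hv⟩ := hb.exists_graph hx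
  obtain ⟨uu, -, huu⟩ := ha.exists_graph huD
  obtain ⟨uv, -, huv⟩ := ha.exists_graph hvD
  obtain ⟨vv, -, hvv⟩ := hb.exists_graph hvD
  have hvu := hab.graph hx hu hv huv
  have lin : ∀ {T : H →ₗ.[ℂ] H} {x y x' y' : H} (c s : ℂ), (x, y) ∈ T.graph → (x', y') ∈ T.graph →
      (c • (x + s • x'), c • (y + s • y')) ∈ T.graph := fun c s h h' =>
    Submodule.smul_mem _ c (Submodule.add_mem _ h (Submodule.smul_mem _ s h'))
  refine ⟨_, _, _, _, hP.2 ⟨_, _, hu, hv, rfl⟩, hQ.2 ⟨_, _, hu, hv, rfl⟩,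
    hP.2 ⟨_, _, lin l (-1) huv huu, lin l (-1) hvv hvu, rfl⟩,
    hQ.2 ⟨_, _, lin k 1 huv huu, lin k 1 hvv hvu, rfl⟩, ?_⟩
  module

end Commutators

/-! ### The adjoint of the lowering operator -/

section Adjoints

variable {H : Type u} [NormedAddCommGroup H] [InnerProductSpace ℂ H] [CompleteSpace H]

/-- Both graphs are cut out by the same coefficient equations, those of the maximal raising
operator. -/
theorem LinearPMap.adjoint_eq_neg_closure (e : HilbertBasis ℕ ℂ H) {A B : H →ₗ.[ℂ] H} {c : ℕ → ℂ}
    (hA : Dense (A.domain : Set H)) (hA' : Dense (A.adjoint.domain : Set H))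
    (hr : ∀ n, (e n, c n • e (n + 1)) ∈ A.graph) (h0 : (e 0, 0) ∈ A.adjoint.graph)
    (hl : ∀ n, (e (n + 1), starRingEnd ℂ (c n) • e n) ∈ A.adjoint.graph)
    (hB : Dense (B.domain : Set H)) (h0' : (e 0, 0) ∈ B.graph)
    {d : ℕ → ℂ} (hl' : ∀ n, (e (n + 1), d n • e n) ∈ B.graph)
    (hr' : ∀ n, (e n, starRingEnd ℂ (d n) • e (n + 1)) ∈ B.adjoint.graph)
    (hd : ∀ n, starRingEnd ℂ (d n) = -c n) :
    B.adjoint = -A.closure := by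
  refine LinearPMap.eq_of_eq_graph ?_
  ext ⟨y, z⟩
  rw [LinearPMap.mem_graph_neg, LinearPMap.mem_graph_closure_of_raising e hA hA' hr h0 hl,
    LinearPMap.mem_graph_adjoint_of_lowering e hB h0' hl' hr']
  simp only [inner_neg_right, hd, neg_mul, neg_eq_iff_eq_neg, neg_zero]

theorem LinearPMap.inner_eq_neg {B : H →ₗ.[ℂ] H} (hB : Dense (B.domain : Set H)) {x u y v : H}
    (hx : (x, -u) ∈ B.adjoint.graph) (hv : (y, v) ∈ B.graph) : inner ℂ v x = -inner ℂ y u := by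
  rw [← inner_neg_right]
  exact (LinearPMap.mem_graph_adjoint hB).1 hx _ hv

end Adjoints

/-! ### The ladder basis for the operators of the theorem -/

section AntiFockOperators

variable {K : Type u} [AddCommGroup K] [Module ℂ K] (S : KreinSpace K)
  (a : S.JSpace →ₗ.[ℂ] S.JSpace)

theorem mem_graph_momentum {x w : S.JSpace} : (x, w) ∈ (momentum S a).graph ↔
    ∃ u v, (x, u) ∈ a.graph ∧ (x, v) ∈ (S.kreinAdjoint a).graph ∧
      w = (1 / (((√2 : ℝ) : ℂ) * Complex.I)) • (v + (1 : ℂ) • u) := by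
  rw [momentum, LinearPMap.mem_graph_smul]
  simp only [LinearPMap.mem_graph_add, one_smul]
  constructor
  · rintro ⟨_, ⟨v, u, hv, hu, rfl⟩, rfl⟩
    exact ⟨u, v, hu, hv, rfl⟩
  · rintro ⟨u, v, hu, hv, rfl⟩
    exact ⟨_, ⟨v, u, hv, hu, rfl⟩, rfl⟩

theorem mem_graph_position {x w : S.JSpace} : (x, w) ∈ (position S a).graph ↔
    ∃ u v, (x, u) ∈ a.graph ∧ (x, v) ∈ (S.kreinAdjoint a).graph ∧
      w = (1 / ((√2 : ℝ) : ℂ)) • (v + (-1 : ℂ) • u) := by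
  rw [position, LinearPMap.mem_graph_smul, sub_eq_add_neg]
  simp only [LinearPMap.mem_graph_add, LinearPMap.mem_graph_neg, neg_one_smul]
  constructor
  · rintro ⟨_, ⟨v, u, hv, hu, rfl⟩, rfl⟩
    exact ⟨-u, v, hu, hv, by rw [neg_neg]⟩
  · rintro ⟨u, v, hu, hv, rfl⟩
    exact ⟨_, ⟨v, -u, hv, by rwa [neg_neg], rfl⟩, rfl⟩

namespace IsAntiFock

variable {S a} {D : Submodule ℂ S.JSpace} {ψ : ℕ → S.JSpace}

/-- A Hilbert basis on which `a` and `a⁺` act as ladder operators, together with the description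
of the adjoint of `a⁺` in this basis. -/
theorem exists_ladder_basis (h : IsAntiFock S a D ψ) : ∃ e : HilbertBasis ℕ ℂ S.JSpace,
    (∀ n : ℕ, (e n, ((√(n + 1 : ℝ) : ℝ) : ℂ) • e (n + 1)) ∈ a.graph) ∧
    (e 0, 0) ∈ (S.kreinAdjoint a).graph ∧
    (∀ n : ℕ, (e (n + 1), -((√(n + 1 : ℝ) : ℝ) : ℂ) • e n) ∈ (S.kreinAdjoint a).graph) ∧
    (S.kreinAdjoint a).adjoint = -a.closure := by
  obtain ⟨e, c, he⟩ := h.exists_basis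
  obtain ⟨σ, hσ, hσc, hσs, hψ⟩ := h.exists_sign
  have hr : ∀ n : ℕ, (e n, ((√(n + 1 : ℝ) : ℝ) : ℂ) • e (n + 1)) ∈ a.graph := fun n => by
    have := a.graph.smul_mem c (h.raise n)
    rwa [Prod.smul_mk, smul_comm c, ← he, ← he] at this
  have h0 : (e 0, 0) ∈ (S.kreinAdjoint a).graph := by
    have := (S.kreinAdjoint a).graph.smul_mem c h.antiFock
    rwa [Prod.smul_mk, smul_zero, ← he] at this
  have hl : ∀ n : ℕ, (e (n + 1), -((√(n + 1 : ℝ) : ℝ) : ℂ) • e n) ∈ (S.kreinAdjoint a).graph :=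
    fun n => by
      have := (S.kreinAdjoint a).graph.smul_mem c (h.lower n)
      rwa [Prod.smul_mk, smul_comm c, ← he, ← he] at this
  have hsymm : ∀ n, S.symm (e n) = σ n • e n := fun n => by
    rw [he, map_smul, hψ, smul_comm]
  have ha := h.dense_domain
  have hb := h.dense_adjoint_domain
  have unsign : ∀ {n y}, (σ n • e n, σ n • y) ∈ a.adjoint.graph → (e n, y) ∈ a.adjoint.graph := by
    intro n y hy
    have := a.adjoint.graph.smul_mem (σ n) hy
    rwa [Prod.smul_mk, smul_smul, smul_smul, hσ, one_smul, one_smul] at this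
  -- Since $J$ is diagonal in the basis, $a^*=Ja^+J$ lowers it too; the alternating signs turn
  -- $-\sqrt{n+1}$ into $\sqrt{n+1}$.
  have h0' : (e 0, 0) ∈ a.adjoint.graph := by
    have := (S.mem_graph_kreinAdjoint ha).1 h0
    rw [hsymm, map_zero S.symm] at this
    exact unsign (by rwa [smul_zero (σ 0)])
  have hl' : ∀ n : ℕ, (e (n + 1), starRingEnd ℂ ((√(n + 1 : ℝ) : ℝ) : ℂ) • e n) ∈
      a.adjoint.graph := by
    intro n
    have := (S.mem_graph_kreinAdjoint ha).1 (hl n)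
    refine unsign ?_
    rw [hsymm, map_smul, hsymm] at this
    rw [Complex.conj_ofReal]
    convert this using 2
    rw [hσs, smul_smul, smul_smul]
    congr 1
    ring
  have ha' : Dense (a.adjoint.domain : Set S.JSpace) := e.dense_of_mem fun n => by
    cases n with
    | zero => exact LinearPMap.mem_domain_of_mem_graph h0'
    | succ n => exact LinearPMap.mem_domain_of_mem_graph (hl' n)
  have hr' : ∀ n : ℕ, (e n, starRingEnd ℂ (-((√(n + 1 : ℝ) : ℝ) : ℂ)) • e (n + 1)) ∈
      (S.kreinAdjoint a).adjoint.graph := by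
    intro n
    refine (LinearPMap.mem_graph_adjoint hb).2 fun p hp => ?_
    -- A pair of $a^+$ is carried by $J$ to a pair of $a^*$, whose coefficients are known; removing
    -- the signs $\sigma$ gives the coefficient equation for $a^+$ on its full domain.
    have h1 : inner ℂ (e n) (S.symm p.2) = starRingEnd ℂ ((√(n + 1 : ℝ) : ℝ) : ℂ) *
        inner ℂ (e (n + 1)) (S.symm p.1) := (LinearPMap.mem_graph_adjoint_of_raising e ha hr h0' hl').1
      ((S.mem_graph_kreinAdjoint ha).1 hp) n
    rw [← S.inner_symm_left, ← S.inner_symm_left, hsymm, hsymm, inner_smul_left, inner_smul_left,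
      hσc, hσc, hσs, Complex.conj_ofReal] at h1
    have h2 : inner ℂ (e n) p.2 = -((√(n + 1 : ℝ) : ℝ) : ℂ) * inner ℂ (e (n + 1)) p.1 := by
      linear_combination σ n * h1 - (inner ℂ (e n) p.2 +
        ((√(n + 1 : ℝ) : ℝ) : ℂ) * inner ℂ (e (n + 1)) p.1) * hσ n
    show inner ℂ p.2 (e n) = inner ℂ p.1 _
    rw [← inner_conj_symm, h2, inner_smul_right, map_mul, inner_conj_symm]
  exact ⟨e, hr, h0, hl, LinearPMap.adjoint_eq_neg_closure e ha ha' hr h0' hl' hb h0 hl hr'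
    fun n => by rw [map_neg, Complex.conj_ofReal]⟩

end IsAntiFock

end AntiFockOperators

/-! ### Assembly of the theorem -/

theorem mainTheorem1 {K : Type u} [AddCommGroup K] [Module ℂ K] (S : KreinSpace K)
    (a : S.JSpace →ₗ.[ℂ] S.JSpace) (D : Submodule ℂ S.JSpace) (ψ : ℕ → S.JSpace)
    (h : IsAntiFock S a D ψ) :
    -- `b = a⁺` satisfies `b* = -a` (up to closure) and `[b, b*] = I`
    (S.kreinAdjoint a).adjoint = -a.closure ∧ -a ≤ (S.kreinAdjoint a).adjoint ∧
    CommutatorEqOn (S.kreinAdjoint a) (S.kreinAdjoint a).adjoint 1 D ∧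
    -- `P̃` and `Q̃` are self-adjoint operators satisfying the CCR
    IsEssentiallySelfAdjoint (momentum S a) ∧ IsEssentiallySelfAdjoint (position S a) ∧
    CommutatorEqOn (momentum S a) (position S a) (-Complex.I) D ∧
    -- the Weyl relations, and the equivalence with a direct sum of Schrödinger representations
    TopologicalSpace.SeparableSpace S.JSpace ∧
    ∃ U V : ℝ → S.JSpace ≃ₗᵢ[ℂ] S.JSpace,
      IsExpI (momentum S a).closure U ∧ IsExpI (position S a).closure V ∧
      WeylRelations U V ∧ IsDirectSumOfSchrodinger U V := by
  obtain ⟨e, hr, h0, hl, hadj⟩ := h.exists_ladder_basis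
  have hneg : ∀ {x u}, (x, u) ∈ a.graph → (x, -u) ∈ (S.kreinAdjoint a).adjoint.graph := by
    intro x u hu
    rw [hadj, LinearPMap.mem_graph_neg, neg_neg]
    exact LinearPMap.le_graph_of_le a.le_closure hu
  have hab : ∀ {x u y v}, (x, u) ∈ a.graph → (y, v) ∈ (S.kreinAdjoint a).graph →
      inner ℂ v x = -inner ℂ y u := fun hu hv =>
    LinearPMap.inner_eq_neg h.dense_adjoint_domain (hneg hu) hv
  obtain ⟨hP, hPc⟩ := ladder_essentiallySelfAdjoint e hr h0 hl hab (T := momentum S a) (Or.inl rfl)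
    (by simp) (by simp [div_eq_mul_inv]) (mem_graph_momentum S a)
  obtain ⟨hQ, hQc⟩ := ladder_essentiallySelfAdjoint e hr h0 hl hab (T := position S a) (Or.inr rfl)
    (by simp) (by simp) (mem_graph_position S a)
  rw [mul_one] at hPc
  rw [mul_neg_one] at hQc
  refine ⟨hadj, ?_, ?_, hP, hQ, ?_, ?_, e.transport translation, e.transport modulation,
    isExpI_transport e hP hPc translation_add hasDerivAt_translation_hermiteBasis,
    isExpI_transport e hQ hQc modulation_add hasDerivAt_modulation_hermiteBasis,
    weylRelations_transport e, isDirectSumOfSchrodinger_transport e⟩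
  · refine LinearPMap.le_of_le_graph ?_
    rintro ⟨x, u⟩ hu
    simpa using hneg (LinearPMap.mem_graph_neg.1 hu)
  · refine commutatorEqOn_iff.2 fun x hx => ?_
    obtain ⟨u, huD, hu⟩ := h.stable.exists_graph hx
    obtain ⟨v, hvD, hv⟩ := h.stable_adjoint.exists_graph hx
    obtain ⟨w, -, hw⟩ := h.stable.exists_graph hvD
    -- On `D` the operator $b^*$ acts as $-a$, so $[b,b^*]=[b,-a]=[a,b]$.
    have hbu := (S.kreinAdjoint a).graph.neg_mem (h.ccr.graph hx hu hv hw)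
    refine ⟨v, -u, _, -w, hv, hneg hu, hbu, hneg hw, ?_⟩
    module
  · have := commutatorEqOn_momentum_position h.stable h.stable_adjoint h.ccr
      (mem_graph_momentum S a) (mem_graph_position S a)
    convert this using 1
    rw [one_div_sqrt_two_mul_I, one_div_sqrt_two]
    have hs : ((√2 : ℝ) : ℂ) * ((√2 : ℝ) : ℂ) = 2 := by
      rw [← Complex.ofReal_mul, Real.mul_self_sqrt (by norm_num)]
      norm_num
    linear_combination Complex.I / 2 * hs
  · have hs := ((Set.countable_range ψ).isSeparable.span (R := ℂ)).closure
    rw [h.complete.closure_eq] at hs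
    exact TopologicalSpace.isSeparable_univ_iff.1 hs
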